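/- **Model.** There are $n$ server queues and $m$ customer types, with compatibility edges $E\subseteq[n]\times[m]$. The state is $q=(q^{(1)},q^{(2)})\in\mathbb Z_+^{n}\times\mathbb Z_+^{m}$. The inverse demand curves $F_j:\mathbb R_+\to\mathbb R$ are strictly decreasing and twice continuously differentiable, and $\lambda F_j(\lambda)$ is concave. The waiting penalties are $s=(s^{(1)},s^{(2)})\ge 0$. The server side is given by a set $\Omega\subseteq\mathbb R_+^n$ of inducible server rates and a cost $c:\Omega\to\mathbb R_+$, of one of two kinds. (i) *Strategic servers.* Continuous inverse supply curves $G_i:\mathbb R_+\to\mathbb R$ and continuous utilities $f_{il}:\mathbb R_+^n\to\mathbb R$ are given. Let $\mathcal M(\mu)$ be the set of $p\in\mathbb R_+^n$ for which there are a row-stochastic matrix $\nu$ and $\hat\mu\in\mathbb R_+^n$ such that $\nu_{il}>0$ implies $f_{il}(p)\ge f_{il'}(p)$ for all $l'$, and such that $G_i(\hat\mu_i)=\max_l f_{il}(p)$ and $\mu_i=\sum_l\hat\mu_l\nu_{li}$ for all $i$. Then $\Omega=\{\mu:\mathcal M(\mu)\ne\emptyset\}$ and $c(\mu)=\inf_{p\in\mathcal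 M(\mu)}\langle\mu,p\rangle$. (ii) *General cost.* $\Omega$ is any Borel subset of $\mathbb R_+^n$ and $c$ is any Borel function $\Omega\to\mathbb R_+$. **Fluid problem.** $\tilde R^\star$ is the maximum of $\sum_jF_j(\lambda_j)\lambda_j-\mathbb E_{\alpha}[c(\mu)]$ over $\lambda\in\mathbb R_+^m$, probability measures $\alpha$ on $\Omega$ and flows $\chi\in\mathbb R_+^{n\times m}$ vanishing off $E$, subject to $\lambda_j=\sum_i\chi_{ij}$ for all $j$ and $\mathbb E_\alpha[\mu_i]=\sum_j\chi_{ij}$ for all $i$. Let $(\lambda^\star,\tilde\alpha^\star,\chi^\star)$ be an optimal solution with $\lambda^\star_j>0$ for all $j$, $\mathbb E_{\tilde\alpha^\star}[\mu_i]>0$ for all $i$, and $\chi^\star_{ij}>0$ for all $(i,j)\in E$. **Markov chain.** In each period, in state $q$, customer rates $\lambda(q)$ are posted and server rates $\mu$ are drawn from $\tilde\alpha^\star$. Given these rates, integer arrivals $a=(a^{(1)},a^{(2)})$, possibly correlated across types, have a law depending only on $(\lambda(q),\mu)$. Assume there is a constant $A_{\max}$ such that, for all customer rates $\lambda$ in a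 neighbourhood of $\lambda^\star$ and $\tilde\alpha^\star$-almost every $\mu$, the arrivals at rates $(\lambda,\mu)$ are almost surely at most $A_{\max}$ and have means $\mathbb E[a^{(1)}]=\mu$ and $\mathbb E[a^{(2)}]=\lambda$. Then a matching $y\in\mathbb Z_+^{n\times m}$, zero off $E$, is chosen with $\sum_jy_{ij}\le q^{(1)}_i+a^{(1)}_i$ and $\sum_iy_{ij}\le q^{(2)}_j+a^{(2)}_j$, and the matched agents leave. The law of the arrivals given the rates does not depend on the scaling parameter $\eta$. **Policy $\pi_\eta$.** With $\epsilon_\eta=\eta^{-1/3}$, set $\lambda_j(q)=\lambda^\star_j+\epsilon_\eta$ if $q^{(2)}_j=0$ and $\lambda_j(q)=\lambda^\star_j-\epsilon_\eta$ otherwise. Server rates are drawn from $\tilde\alpha^\star$ in every state. The matching $y$ maximizes $\sum_{(i,j)\in E}y_{ij}(q^{(1)}_i+q^{(2)}_j)$ over the feasible matchings, with ties broken by any fixed rule depending on $(q,a)$. **Theorem.** There are constants $K$ and $\eta_0$ such that, for every $\eta\ge\eta_0$ and every tie-breaking rule, the chain under $\pi_\eta$ has a stationary distribution carried by the states reachable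 from the empty system, and for every stationary distribution the net profit $$R_\eta(\pi_\eta)=\mathbb E_{\bar q}\Big[\eta\Big(\sum_jF_j(\lambda_j(\bar q))\lambda_j(\bar q)-\mathbb E_{\tilde\alpha^\star}[c(\mu)]\Big)-\langle s,\bar q\rangle\Big]$$ is a well-defined finite expectation and the net profit-loss $L_\eta(\pi_\eta)=\eta\tilde R^\star-R_\eta(\pi_\eta)$ satisfies $|L_\eta(\pi_\eta)|\le K\eta^{1/3}$. -/

import Mathlib

open MeasureTheory ProbabilityTheory Filter Topology

noncomputable section

namespace TwoSidedQueue

/-- Queue lengths, or the numbers of arrivals in one period: the first component counts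
servers of the `n` server queues, the second one customers of the `m` customer types. -/
abbrev State (n m : ℕ) : Type := (Fin n → ℕ) × (Fin m → ℕ)

/-! ### Strategic servers and the cost function -/

/-- Primitives of the strategic server side: inverse supply curves `G i : ℝ₊ → ℝ` and utilities
`f i l p`, the utility of a type-`i` server in queue `l` at the price vector `p ∈ ℝ₊ⁿ`. -/
structure SupplyModel (n : ℕ) where
  G : Fin n → ℝ → ℝ
  f : Fin n → Fin n → (Fin n → ℝ) → ℝ
  G_cont : ∀ i, ContinuousOn (G i) (Set.Ici 0)
  f_cont : ∀ i l, ContinuousOn (f i l) (Set.Ici 0)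

/-- The price vectors consistent with the rate vector `μ`: at such a price some strategy profile
`ν` (whose rows are probability vectors) is an equilibrium, and with type arrival rates `μh`
solving `G i (μh i) = max_l u_il` it brings rate `μ i` to queue `i`. -/
def SupplyModel.consistentPrices {n : ℕ} (S : SupplyModel n) (μ : Fin n → ℝ) :
    Set (Fin n → ℝ) :=
  {p | 0 ≤ p ∧ ∃ (ν : Fin n → Fin n → ℝ) (μh : Fin n → ℝ),
    (∀ i, ν i ∈ stdSimplex ℝ (Fin n)) ∧
    (∀ i l, 0 < ν i l → ∀ l', S.f i l' p ≤ S.f i l p) ∧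
    (∀ i, 0 ≤ μh i) ∧
    (∀ i, S.G i (μh i) = ⨆ l, S.f i l p) ∧
    (∀ i, μ i = ∑ l, μh l * ν l i)}

/-- An arbitrary Borel cost function `c : Ω → ℝ₊` on a Borel set `Ω` of server rates.
Values of `c` outside `Ω` play no role. -/
structure CostFunction (n : ℕ) where
  Ω : Set (Fin n → ℝ)
  c : (Fin n → ℝ) → ℝ
  Ω_nonneg : ∀ μ ∈ Ω, 0 ≤ μ
  Ω_meas : MeasurableSet Ω
  c_nonneg : ∀ μ ∈ Ω, 0 ≤ c μ
  c_meas : Measurable fun μ : Ω => c μ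

/-- The server side of the market: either the strategic model, whose cost is the cheapest
consistent payment, or a general cost function (other notions of equilibrium behaviour). -/
inductive ServerSide (n : ℕ) where
  | strategic (S : SupplyModel n)
  | general (C : CostFunction n)

/-- The set `Ω` of server rate vectors that can be induced. -/
def ServerSide.rates {n : ℕ} : ServerSide n → Set (Fin n → ℝ)
  | .strategic S => {μ | (S.consistentPrices μ).Nonempty}
  | .general C => C.Ω

/-- The cost `c(μ)` per period of inducing the rates `μ ∈ Ω`; in the strategic model the minimum
of `⟨μ, p⟩` over the consistent prices `p`. -/
def ServerSide.cost {n : ℕ} : ServerSide n → (Fin n → ℝ) → ℝ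
  | .strategic S => fun μ => sInf ((fun p => ∑ i, μ i * p i) '' S.consistentPrices μ)
  | .general C => C.c

/-! ### The market -/

/-- The data of the two-sided system: the compatibility graph `E`, inverse demand curves `F`,
the server side, waiting penalties `s₁` (servers), `s₂` (customers), and, for posted customer
rates `r` and server rates `μ`, the joint law `arrivals r μ` of the numbers of arrivals in one
period (possibly correlated across all types). -/
structure Market (n m : ℕ) where
  E : Set (Fin n × Fin m)
  F : Fin m → ℝ → ℝ
  F_strictAnti : ∀ j, StrictAntiOn (F j) (Set.Ici 0)
  F_contDiff : ∀ j, ContDiffOn ℝ 2 (F j) (Set.Ici 0)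
  F_concave : ∀ j, ConcaveOn ℝ (Set.Ici 0) (fun x => x * F j x)
  servers : ServerSide n
  s₁ : Fin n → ℝ
  s₂ : Fin m → ℝ
  s₁_nonneg : ∀ i, 0 ≤ s₁ i
  s₂_nonneg : ∀ j, 0 ≤ s₂ j
  arrivals : (Fin m → ℝ) → Kernel (Fin n → ℝ) (State n m)
  arrivals_markov : ∀ r, IsMarkovKernel (arrivals r)

variable {n m : ℕ}

/-- At the rates `(r, μ)` the arrivals of every type are at most `A` almost surely and have
means `μ` (servers) and `r` (customers). -/
def Market.ProperArrivals (M : Market n m) (A : ℝ) (r : Fin m → ℝ) (μ : Fin n → ℝ) : Prop :=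
  (∀ᵐ a ∂(M.arrivals r μ), (∀ i, (a.1 i : ℝ) ≤ A) ∧ ∀ j, (a.2 j : ℝ) ≤ A) ∧
  (∀ i, ∫ a, (a.1 i : ℝ) ∂(M.arrivals r μ) = μ i) ∧
  (∀ j, ∫ a, (a.2 j : ℝ) ∂(M.arrivals r μ) = r j)

/-! ### The probabilistic fluid problem -/

/-- Decision variables of the fluid problem: customer rates, a distribution over server rates,
and matching flows. -/
structure FluidPoint (n m : ℕ) where
  rate : Fin m → ℝ
  α : Measure (Fin n → ℝ)
  χ : Fin n → Fin m → ℝ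

/-- Feasibility in the fluid problem. The cost is nonnegative, so asking for its integrability
only removes points whose objective value would be `-∞`. -/
structure Market.IsFluidFeasible (M : Market n m) (x : FluidPoint n m) : Prop where
  prob : IsProbabilityMeasure x.α
  supp : ∀ᵐ μ ∂x.α, μ ∈ M.servers.rates
  integrable_cost : Integrable M.servers.cost x.α
  integrable_rate : ∀ i, Integrable (fun μ => μ i) x.α
  customer_balance : ∀ j, x.rate j = ∑ i, x.χ i j
  server_balance : ∀ i, ∫ μ, μ i ∂x.α = ∑ j, x.χ i j
  flow_off : ∀ i j, (i, j) ∉ M.E → x.χ i j = 0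
  flow_nonneg : ∀ i j, (i, j) ∈ M.E → 0 ≤ x.χ i j

/-- The fluid objective `⟨F(λ), λ⟩ - E_α[c(μ)]`. -/
def Market.fluidProfit (M : Market n m) (x : FluidPoint n m) : ℝ :=
  ∑ j, M.F j (x.rate j) * x.rate j - ∫ μ, M.servers.cost μ ∂x.α

/-- `x` is an optimal solution of the fluid problem. -/
def Market.IsFluidOptimal (M : Market n m) (x : FluidPoint n m) : Prop :=
  M.IsFluidFeasible x ∧ ∀ x', M.IsFluidFeasible x' → M.fluidProfit x' ≤ M.fluidProfit x

/-- The optimal value of the fluid problem. -/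
def Market.fluidOptimum (M : Market n m) : ℝ :=
  sSup (M.fluidProfit '' {x | M.IsFluidFeasible x})

/-! ### Policies and the Markov chain -/

/-- A decision `v` (`v i j` pairs of a server from queue `i` and a customer of type `j`) is
feasible at queue lengths `q` and arrivals `a`. -/
def FeasibleMatching (E : Set (Fin n × Fin m)) (q a : State n m) (v : Fin n → Fin m → ℕ) : Prop :=
  (∀ i, ∑ j, v i j ≤ q.1 i + a.1 i) ∧ (∀ j, ∑ i, v i j ≤ q.2 j + a.2 j) ∧
  ∀ i j, (i, j) ∉ E → v i j = 0

/-- A matching rule: the matching chosen at queue lengths `q` (before arrivals) and arrivals `a`. -/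
abbrev MatchingRule (n m : ℕ) : Type := State n m → State n m → Fin n → Fin m → ℕ

/-- The objective of max-weight matching, with the queue lengths before arrivals as weights. -/
def matchingWeight (q : State n m) (v : Fin n → Fin m → ℕ) : ℕ :=
  ∑ i, ∑ j, v i j * (q.1 i + q.2 j)

/-- A max-weight matching rule; ties may be broken in any way. -/
def IsMaxWeight (E : Set (Fin n × Fin m)) (y : MatchingRule n m) : Prop :=
  ∀ q a, FeasibleMatching E q a (y q a) ∧
    ∀ v, FeasibleMatching E q a v → matchingWeight q v ≤ matchingWeight q (y q a)

/-- A stationary policy: state-dependent customer rates, state-dependent distributions of the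
server rates, and a matching rule. -/
structure Policy (n m : ℕ) where
  rate : State n m → Fin m → ℝ
  α : State n m → Measure (Fin n → ℝ)
  matching : MatchingRule n m

/-- The two-price policy around the fluid point `x`, with matching rule `y`. -/
def twoPricePolicy (x : FluidPoint n m) (ε : ℝ) (y : MatchingRule n m) : Policy n m where
  rate := fun q j => if q.2 j = 0 then x.rate j + ε else x.rate j - ε
  α := fun _ => x.α
  matching := y

/-- Queue lengths after arrivals `a` and matching `v`. The subtraction is exact
when `v` is feasible. -/
def nextState (q a : State n m) (v : Fin n → Fin m → ℕ) : State n m :=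
  (fun i => q.1 i + a.1 i - ∑ j, v i j, fun j => q.2 j + a.2 j - ∑ i, v i j)

/-- The transition kernel of the queue-length chain under `π`: in state `q` the server rates `μ`
are drawn from `π.α q`, then arrivals from `M.arrivals (π.rate q) μ`, then pairs are matched. -/
def Market.transition (M : Market n m) (π : Policy n m) : Kernel (State n m) (State n m) :=
  Kernel.ofFunOfCountable fun q =>
    ((π.α q).bind (M.arrivals (π.rate q))).map fun a => nextState q a (π.matching q a)

/-- `ψ` is a stationary distribution of the chain under `π`. -/
def Market.IsStationary (M : Market n m) (π : Policy n m) (ψ : Measure (State n m)) : Prop :=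
  IsProbabilityMeasure ψ ∧ Kernel.Invariant (M.transition π) ψ

/-- `q` can be reached from the empty system under `π`. -/
def Market.Reachable (M : Market n m) (π : Policy n m) (q : State n m) : Prop :=
  Relation.ReflTransGen (fun q₁ q₂ => M.transition π q₁ {q₂} ≠ 0) 0 q

/-- Net profit per unit of time in state `q` in the system with scaling parameter `η`: there are
`η` periods per unit of time, while the waiting penalty is charged on the queue lengths. -/
def Market.netReward (M : Market n m) (η : ℝ) (π : Policy n m) (q : State n m) : ℝ :=
  η * (∑ j, M.F j (π.rate q j) * π.rate q j - ∫ μ, M.servers.cost μ ∂(π.α q))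
    - (∑ i, M.s₁ i * (q.1 i : ℝ) + ∑ j, M.s₂ j * (q.2 j : ℝ))

/-- The net profit-loss against the scaled fluid optimum, in the stationary regime `ψ`. -/
def Market.netProfitLoss (M : Market n m) (η : ℝ) (π : Policy n m) (ψ : Measure (State n m)) : ℝ :=
  η * M.fluidOptimum - ∫ q, M.netReward η π q ∂ψ

end TwoSidedQueue

end

open TwoSidedQueue

/-!
The two-price policy loses a revenue of order `η * ε ^ 2` and a waiting cost of order `1 / ε`, where
`ε = η ^ (-1 / 3)` is the price gap; for this gap both are of order `η ^ (1 / 3)`.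

*Waiting cost.* A max-weight matching leaves no compatible pair of positive weight, so after one
step the chain stays in the separated states, where every compatible pair of queues has a queue of
length at most the arrival bound (`nextState_mem_separatedStates`). There the number of
matched pairs is bounded, and the drift of the quadratic Lyapunov function is, up to a constant,
linear in the queue lengths. The max-weight value is bounded from below by a single matching that
serves each long server queue with all the customers of the types that choose it, and vice versa
(`le_matchingWeight`). Compared with the fluid flow, it yields a drift of at most
`constant - c * ε * (number of waiting agents)` (`linear_drift_le`). The servers, whose rates are
not controlled, also gain from the gap: an empty customer type arrives faster by `ε`, and a
nonempty one can offer a waiting customer. Foster's criterion turns the drift into the existence of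
a stationary distribution (`MarkovChain.exists_invariant_of_drift`) and into a bound of order
`1 / ε` on the mean queue lengths (`MarkovChain.lintegral_le_of_drift`).

*Revenue.* The posted rates differ from the fluid rates by `ε`, so only the first-order term of the
revenue needs care. By stationarity, the mean numbers of matched pairs form a fluid flow whose
customer rates are the mean posted rates and whose server rates are those of the fluid
solution. All flows of the optimal solution being positive, it can be moved both towards and
away from this flow, so the derivative of the fluid profit in this direction vanishes, and with
it the first-order term (`Market.IsFluidOptimal.sum_deriv_mul_eq_zero`).
-/

open scoped ENNReal

/-! ### Markov chains with a drift condition -/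

namespace MarkovChain

variable {Z : Type*} [MeasurableSpace Z]

/-- The `k`-step transition kernel of the chain with one-step kernel `P`. -/
noncomputable def iter (P : Kernel Z Z) : ℕ → Kernel Z Z
  | 0 => Kernel.id
  | k + 1 => P ∘ₖ iter P k

instance iter_isMarkovKernel (P : Kernel Z Z) [IsMarkovKernel P] (k : ℕ) :
    IsMarkovKernel (iter P k) := by
  induction k with
  | zero => unfold iter; infer_instance
  | succ k ih => unfold iter; infer_instance

theorem invariant_iter {P : Kernel Z Z} {ψ : Measure Z} (h : Kernel.Invariant P ψ) (k : ℕ) :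
    Kernel.Invariant (iter P k) ψ := by
  induction k with
  | zero => simp [iter, Kernel.Invariant]
  | succ k ih => exact h.comp ih

theorem lintegral_lintegral_of_invariant {P : Kernel Z Z} {ψ : Measure Z}
    (h : Kernel.Invariant P ψ) {f : Z → ℝ≥0∞} (hf : Measurable f) :
    ∫⁻ z, ∫⁻ w, f w ∂P z ∂ψ = ∫⁻ z, f z ∂ψ := by
  conv_rhs => rw [← h.def]
  rw [Measure.lintegral_bind P.measurable.aemeasurable hf.aemeasurable]

theorem integral_integral_of_invariant {P : Kernel Z Z} {ψ : Measure Z}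
    (h : Kernel.Invariant P ψ) {g : Z → ℝ} (hg : Integrable g ψ) :
    ∫ z, ∫ w, g w ∂P z ∂ψ = ∫ z, g z ∂ψ := by
  have e : (P ∘ₖ Kernel.const Unit ψ) () = ψ := by
    rw [Kernel.comp_apply, Kernel.const_apply, h.def]
  have := Kernel.integral_comp (η := P) (κ := Kernel.const Unit ψ) (a := ()) (f := g)
    (by rwa [e])
  rw [e, Kernel.const_apply] at this
  exact this.symm

section Drift

variable [Countable Z] [MeasurableSingletonClass Z] {P : Kernel Z Z} [IsMarkovKernel P]
  {V f : Z → ℝ≥0∞} {b : ℝ≥0∞}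

/-- Telescoping of the drift inequality along the chain. -/
theorem sum_lintegral_iter_le (hdrift : ∀ z, ∫⁻ w, V w ∂P z + f z ≤ V z + b) (N : ℕ) (z : Z) :
    ∑ k ∈ Finset.range N, ∫⁻ w, f w ∂iter P k z + ∫⁻ w, V w ∂iter P N z ≤ V z + N * b := by
  have hm (g : Z → ℝ≥0∞) : Measurable g := measurable_of_countable g
  induction N with
  | zero => simp [iter, Kernel.id_apply, lintegral_dirac' _ (hm V)]
  | succ N ih =>
    have key : ∫⁻ w, V w ∂iter P (N + 1) z + ∫⁻ w, f w ∂iter P N z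
        ≤ ∫⁻ w, V w ∂iter P N z + b := by
      rw [iter, Kernel.lintegral_comp _ _ _ (hm V), ← lintegral_add_left (hm _)]
      calc _ ≤ ∫⁻ w, (V w + b) ∂iter P N z := lintegral_mono hdrift
        _ = _ := by rw [lintegral_add_left (hm _)]; simp
    rw [Finset.sum_range_succ]
    calc _ = ∑ k ∈ Finset.range N, ∫⁻ w, f w ∂iter P k z +
          (∫⁻ w, V w ∂iter P (N + 1) z + ∫⁻ w, f w ∂iter P N z) := by ring
      _ ≤ ∑ k ∈ Finset.range N, ∫⁻ w, f w ∂iter P k z + (∫⁻ w, V w ∂iter P N z + b) := by gcongr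
      _ = (∑ k ∈ Finset.range N, ∫⁻ w, f w ∂iter P k z + ∫⁻ w, V w ∂iter P N z) + b := by ring
      _ ≤ V z + N * b + b := by gcongr
      _ = _ := by push_cast; ring

/-- **Foster's moment bound.** Under the drift condition, `f` has mean at most `b` in every
stationary distribution. Integrability of `V` is not assumed, so the drift inequality cannot be
integrated directly; instead time averages of a truncation of `f` are compared with `V / N + b`. -/
theorem lintegral_le_of_drift (hdrift : ∀ z, ∫⁻ w, V w ∂P z + f z ≤ V z + b)
    {ψ : Measure Z} [IsProbabilityMeasure ψ] (hψ : Kernel.Invariant P ψ)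
    (hV : ∀ᵐ z ∂ψ, V z ≠ ∞) : ∫⁻ z, f z ∂ψ ≤ b := by
  have hm (g : Z → ℝ≥0∞) : Measurable g := measurable_of_countable g
  have trunc (M : ℕ) : ∫⁻ z, min (f z) M ∂ψ ≤ b := by
    have hd (z : Z) : ∫⁻ w, V w ∂P z + min (f z) M ≤ V z + b :=
      le_trans (by gcongr; exact min_le_left _ _) (hdrift z)
    have avg (N : ℕ) : ∫⁻ z, min (f z) M ∂ψ
        ≤ ∫⁻ z, min (M : ℝ≥0∞) (V z / (N + 1 : ℕ) + b) ∂ψ := by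
      have h0 : ((N + 1 : ℕ) : ℝ≥0∞) ≠ 0 := by simp
      have h1 : ((N + 1 : ℕ) : ℝ≥0∞) ≠ ∞ := ENNReal.natCast_ne_top _
      have e : ∫⁻ z, ∑ k ∈ Finset.range (N + 1), ∫⁻ w, min (f w) M ∂iter P k z ∂ψ
          = (N + 1 : ℕ) * ∫⁻ z, min (f z) M ∂ψ := by
        rw [lintegral_finsetSum _ (fun _ _ => hm _)]
        rw [Finset.sum_congr rfl (fun k _ =>
          lintegral_lintegral_of_invariant (invariant_iter hψ k) (hm _))]
        simp
      have : ∫⁻ z, min (f z) M ∂ψ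
          = ∫⁻ z, (∑ k ∈ Finset.range (N + 1), ∫⁻ w, min (f w) M ∂iter P k z) / (N + 1 : ℕ) ∂ψ := by
        simp_rw [div_eq_mul_inv]
        rw [lintegral_mul_const _ (hm _), e, mul_comm, ← mul_assoc, ENNReal.inv_mul_cancel h0 h1,
          one_mul]
      rw [this]
      refine lintegral_mono fun z => le_min ?_ ?_
      · refine ENNReal.div_le_of_le_mul' ?_
        calc _ ≤ ∑ k ∈ Finset.range (N + 1), (M : ℝ≥0∞) := by
              refine Finset.sum_le_sum fun k _ => ?_
              calc _ ≤ ∫⁻ w, (M : ℝ≥0∞) ∂iter P k z := lintegral_mono fun w => min_le_right _ _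
                _ = _ := by simp
          _ = _ := by simp
      · refine ENNReal.div_le_of_le_mul' ?_
        rw [mul_add, ENNReal.mul_div_cancel h0 h1]
        exact le_trans le_self_add (sum_lintegral_iter_le hd (N + 1) z)
    have lim : Tendsto (fun N : ℕ => ∫⁻ z, min (M : ℝ≥0∞) (V z / (N + 1 : ℕ) + b) ∂ψ) atTop
        (𝓝 (∫⁻ z, min (M : ℝ≥0∞) (0 + b) ∂ψ)) := by
      refine tendsto_lintegral_of_dominated_convergence (fun _ => (M : ℝ≥0∞)) (fun _ => hm _)
        (fun N => ae_of_all _ fun z => min_le_left _ _) (by simp) ?_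
      filter_upwards [hV] with z hz
      refine Tendsto.min tendsto_const_nhds (Tendsto.add ?_ tendsto_const_nhds)
      have := (ENNReal.Tendsto.const_div (a := V z) ENNReal.tendsto_nat_nhds_top (Or.inr hz))
      rw [ENNReal.div_top] at this
      exact this.comp (tendsto_add_atTop_nat 1)
    refine le_trans (ge_of_tendsto' lim avg) ?_
    calc _ ≤ ∫⁻ z, b ∂ψ := lintegral_mono fun z => by simp
      _ = b := by simp
  have mono : ∫⁻ z, f z ∂ψ = ⨆ M : ℕ, ∫⁻ z, min (f z) M ∂ψ := by
    rw [← lintegral_iSup (fun _ => hm _)]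
    · refine lintegral_congr fun z => ?_
      rw [← inf_iSup_eq, ENNReal.iSup_natCast, inf_top_eq]
    · intro M M' h z
      exact min_le_min le_rfl (by exact_mod_cast h)
  rw [mono]
  exact iSup_le trunc

/-- **Existence of a stationary distribution** (Krylov–Bogoliubov). The drift condition bounds the
mean of `f` under the time averages of the chain started at `z₀`. As `f` has finite sublevel sets,
their pointwise limit along an ultrafilter loses no mass. The limit dominates its own
image under `P`, and both are probability measures, so they agree. -/
theorem exists_invariant_of_drift (hdrift : ∀ z, ∫⁻ w, V w ∂P z + f z ≤ V z + b) (hb : b ≠ ∞)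
    (hfin : ∀ R : ℝ≥0∞, R ≠ ∞ → {z | f z ≤ R}.Finite) {z₀ : Z} (hz₀ : V z₀ ≠ ∞) :
    ∃ ψ : Measure Z, IsProbabilityMeasure ψ ∧ Kernel.Invariant P ψ ∧
      ∀ᵐ z ∂ψ, Relation.ReflTransGen (fun z w => P z {w} ≠ 0) z₀ z := by
  have hm (g : Z → ℝ≥0∞) : Measurable g := measurable_of_countable g
  have hms (s : Set Z) : MeasurableSet s := s.to_countable.measurableSet
  -- the laws of the chain from `z₀`, averaged over the first `N + 1` periods
  let A : ℕ → Measure Z := fun N =>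
    ((N + 1 : ℕ) : ℝ≥0∞)⁻¹ • ∑ k ∈ Finset.range (N + 1), iter P k z₀
  have hA_apply (N : ℕ) (s : Set Z) :
      A N s = ((N + 1 : ℕ) : ℝ≥0∞)⁻¹ * ∑ k ∈ Finset.range (N + 1), iter P k z₀ s := by
    simp [A]
  have h0 (N : ℕ) : ((N + 1 : ℕ) : ℝ≥0∞) ≠ 0 := by simp
  have h1 (N : ℕ) : ((N + 1 : ℕ) : ℝ≥0∞) ≠ ∞ := ENNReal.natCast_ne_top _
  have hA_prob (N : ℕ) : IsProbabilityMeasure (A N) := by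
    constructor
    rw [hA_apply]
    simp only [measure_univ, Finset.sum_const, Finset.card_range, nsmul_eq_mul, mul_one]
    exact ENNReal.inv_mul_cancel (h0 N) (h1 N)
  have hA_moment (N : ℕ) : ∫⁻ z, f z ∂A N ≤ V z₀ + b := by
    rw [lintegral_smul_measure, lintegral_finsetSum_measure, smul_eq_mul,
      ENNReal.inv_mul_le_iff (h0 N) (h1 N)]
    calc _ ≤ V z₀ + (N + 1 : ℕ) * b :=
          le_trans le_self_add (sum_lintegral_iter_le hdrift (N + 1) z₀)
      _ ≤ (N + 1 : ℕ) * V z₀ + (N + 1 : ℕ) * b := by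
          gcongr
          exact le_mul_of_one_le_left zero_le (by simp)
      _ = _ := by ring
  have hA_step (N : ℕ) (w : Z) :
      ∫⁻ z, P z {w} ∂A N ≤ A N {w} + ((N + 1 : ℕ) : ℝ≥0∞)⁻¹ := by
    rw [lintegral_smul_measure, lintegral_finsetSum_measure, smul_eq_mul, hA_apply]
    conv_rhs => rw [← mul_one ((N + 1 : ℕ) : ℝ≥0∞)⁻¹, mul_assoc, one_mul, ← mul_add]
    gcongr
    have e (k : ℕ) : ∫⁻ z, P z {w} ∂iter P k z₀ = iter P (k + 1) z₀ {w} := by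
      rw [iter, Kernel.comp_apply' _ _ _ (hms _)]
    rw [Finset.sum_congr rfl (fun k _ => e k)]
    calc _ ≤ ∑ k ∈ Finset.range (N + 1 + 1), iter P k z₀ {w} := by
          rw [Finset.sum_range_succ' (n := N + 1)]; exact le_self_add
      _ ≤ _ := by
          rw [Finset.sum_range_succ]
          gcongr
          exact prob_le_one
  -- the probabilities lie in a compact space, so an ultrafilter gives all limits at once
  let U : Ultrafilter ℕ := Filter.hyperfilter ℕ
  have hU : (U : Filter ℕ) ≤ atTop := by
    rw [← Nat.cofinite_eq_atTop]; exact Filter.hyperfilter_le_cofinite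
  let p : Z → ℝ≥0∞ := fun z => (U.map fun N => A N {z}).lim
  have hp (z : Z) : Tendsto (fun N => A N {z}) U (𝓝 (p z)) :=
    Ultrafilter.le_nhds_lim (U.map fun N => A N {z})
  have hp_fin (s : Finset Z) : Tendsto (fun N => A N s) U (𝓝 (∑ z ∈ s, p z)) := by
    have e (N : ℕ) : A N s = ∑ z ∈ s, A N {z} := by
      rw [← sum_measure_singleton]
    simp_rw [e]
    exact tendsto_finsetSum _ fun z _ => hp z
  let ψ : Measure Z := Measure.sum fun z => p z • Measure.dirac z
  have hψ_single (z : Z) : ψ {z} = p z := by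
    rw [Measure.sum_apply _ (hms _), tsum_eq_single z]
    · simp
    · intro w hw; simp [hw]
  have hψ_fin (s : Finset Z) : ψ s = ∑ z ∈ s, p z := by
    rw [← sum_measure_singleton]; simp [hψ_single]
  have hψ_le : ψ Set.univ ≤ 1 := by
    rw [Measure.sum_apply _ (hms _)]
    simp only [Measure.smul_apply, measure_univ, smul_eq_mul, mul_one]
    rw [ENNReal.tsum_eq_iSup_sum]
    exact iSup_le fun s => le_of_tendsto' (hp_fin s) fun N => prob_le_one
  have hψ_ge : 1 ≤ ψ Set.univ := by
    have hC : V z₀ + b ≠ ∞ := ENNReal.add_ne_top.2 ⟨hz₀, hb⟩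
    have bound (R : ℕ) : 1 ≤ ψ Set.univ + (V z₀ + b) / (R + 1 : ℕ) := by
      let s : Finset Z := (hfin (R + 1 : ℕ) (ENNReal.natCast_ne_top _)).toFinset
      have hs (N : ℕ) : 1 ≤ A N s + (V z₀ + b) / (R + 1 : ℕ) := by
        have hc : A N (s : Set Z)ᶜ ≤ (V z₀ + b) / (R + 1 : ℕ) := by
          calc _ ≤ A N {z | ((R + 1 : ℕ) : ℝ≥0∞) ≤ f z} := by
                refine measure_mono fun z hz => ?_
                simp only [s, Set.Finite.coe_toFinset, Set.mem_compl_iff, Set.mem_ofPred_eq,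
                  not_le] at hz
                exact hz.le
            _ ≤ (∫⁻ z, f z ∂A N) / (R + 1 : ℕ) :=
                meas_ge_le_lintegral_div (hm f).aemeasurable (h0 R) (h1 R)
            _ ≤ _ := by gcongr; exact hA_moment N
        calc (1 : ℝ≥0∞) = A N s + A N (s : Set Z)ᶜ := by
              rw [measure_add_measure_compl (hms _), measure_univ]
          _ ≤ _ := by gcongr
      have := ge_of_tendsto' ((hp_fin s).add_const ((V z₀ + b) / (R + 1 : ℕ))) hs
      rw [← hψ_fin] at this
      exact this.trans (by gcongr; exact Set.subset_univ _)
    have lim : Tendsto (fun R : ℕ => ψ Set.univ + (V z₀ + b) / (R + 1 : ℕ)) atTop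
        (𝓝 (ψ Set.univ + 0)) := by
      refine tendsto_const_nhds.add ?_
      have := (ENNReal.Tendsto.const_div (a := V z₀ + b) ENNReal.tendsto_nat_nhds_top (Or.inr hC))
      rw [ENNReal.div_top] at this
      exact this.comp (tendsto_add_atTop_nat 1)
    simpa using ge_of_tendsto' lim bound
  have hψ_prob : IsProbabilityMeasure ψ := ⟨le_antisymm hψ_le hψ_ge⟩
  have hint (g : Z → ℝ≥0∞) : ∫⁻ z, g z ∂ψ = ∑' z, g z * p z := by
    rw [lintegral_countable']; simp_rw [hψ_single]
  have hsub (w : Z) : ψ.bind P {w} ≤ ψ {w} := by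
    rw [Measure.bind_apply (hms _) P.measurable.aemeasurable, hint, ENNReal.tsum_eq_iSup_sum,
      hψ_single]
    refine iSup_le fun s => ?_
    have l1 : Tendsto (fun N => ∑ z ∈ s, P z {w} * A N {z}) U (𝓝 (∑ z ∈ s, P z {w} * p z)) :=
      tendsto_finsetSum _ fun z _ =>
        ENNReal.Tendsto.const_mul (hp z) (Or.inr (measure_ne_top _ _))
    have l2 : Tendsto (fun N => A N {w} + ((N + 1 : ℕ) : ℝ≥0∞)⁻¹) U (𝓝 (p w + 0)) :=
      (hp w).add ((ENNReal.tendsto_inv_nat_nhds_zero.comp (tendsto_add_atTop_nat 1)).mono_left hU)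
    rw [add_zero] at l2
    refine le_of_tendsto_of_tendsto' l1 l2 fun N => le_trans ?_ (hA_step N w)
    rw [lintegral_countable']
    exact ENNReal.sum_le_tsum s
  have hle : ψ.bind P ≤ ψ := by
    refine Measure.le_iff.2 fun s _ => ?_
    rw [← Set.biUnion_of_singleton s, measure_biUnion s.to_countable
      (fun a _ b _ hab => by simpa using hab) (fun _ _ => hms _),
      measure_biUnion s.to_countable
      (fun a _ b _ hab => by simpa using hab) (fun _ _ => hms _)]
    exact ENNReal.tsum_le_tsum fun z => hsub z
  refine ⟨ψ, hψ_prob, Measure.eq_of_le_of_isProbabilityMeasure hle, ?_⟩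
  have hreach (k : ℕ) (z : Z) (hz : ¬ Relation.ReflTransGen (fun z w => P z {w} ≠ 0) z₀ z) :
      iter P k z₀ {z} = 0 := by
    induction k generalizing z with
    | zero =>
      have : z₀ ≠ z := fun h => hz (h ▸ .refl)
      simp [iter, Kernel.id_apply, this]
    | succ k ih =>
      rw [iter, Kernel.comp_apply' _ _ _ (hms _), lintegral_countable', ENNReal.tsum_eq_zero]
      intro y
      by_cases hy : Relation.ReflTransGen (fun z w => P z {w} ≠ 0) z₀ y
      · have : P y {z} = 0 := by
          by_contra h; exact hz (hy.tail h)
        simp [this]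
      · simp [ih y hy]
  rw [ae_iff_of_countable]
  intro z hz
  by_contra hn
  refine hz ?_
  have : ∀ N, A N {z} = 0 := fun N => by
    rw [hA_apply, Finset.sum_eq_zero (fun k _ => hreach k z hn), mul_zero]
  rw [hψ_single]
  refine tendsto_nhds_unique (hp z) ?_
  simp [this]

end Drift

end MarkovChain

/-! ### Max-weight matchings -/

namespace TwoSidedQueue

variable {n m : ℕ}

/-- The states in which every compatible pair of queues has a queue of length at most `N`. -/
def separatedStates (E : Set (Fin n × Fin m)) (N : ℕ) : Set (State n m) :=
  {q | ∀ i j, (i, j) ∈ E → q.1 i ≤ N ∨ q.2 j ≤ N}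

/-- At most `N` agents of every type arrive. -/
def ArrivalsLE (N : ℕ) (a : State n m) : Prop :=
  (∀ i, a.1 i ≤ N) ∧ ∀ j, a.2 j ≤ N

/-- A max-weight matching leaves no compatible pair of positive weight unmatched, so two compatible
queues can both stay nonempty only if both were empty before the arrivals. -/
theorem nextState_mem_separatedStates {E : Set (Fin n × Fin m)} {y : MatchingRule n m}
    (hy : IsMaxWeight E y) {N : ℕ} (q : State n m) {a : State n m} (ha : ArrivalsLE N a) :
    nextState q a (y q a) ∈ separatedStates E N := by
  intro i j hij
  by_contra! hcon
  obtain ⟨⟨hf1, hf2, hf3⟩, hmax⟩ := hy q a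
  simp only [nextState] at hcon
  obtain ⟨h1, h2⟩ := hcon
  have hpos : 0 < q.1 i + q.2 j := by
    have := ha.1 i
    omega
  let v : Fin n → Fin m → ℕ := fun i' j' => y q a i' j' + if i' = i ∧ j' = j then 1 else 0
  have hrow (i' : Fin n) : ∑ j', v i' j' = ∑ j', y q a i' j' + if i' = i then 1 else 0 := by
    simp only [v, Finset.sum_add_distrib]
    by_cases h : i' = i <;> simp [h]
  have hcol (j' : Fin m) : ∑ i', v i' j' = ∑ i', y q a i' j' + if j' = j then 1 else 0 := by
    simp only [v, Finset.sum_add_distrib]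
    by_cases h : j' = j <;> simp [h]
  have hv : FeasibleMatching E q a v := by
    refine ⟨fun i' => ?_, fun j' => ?_, fun i' j' h => ?_⟩
    · rw [hrow]
      have := hf1 i'
      split_ifs with h
      · subst h; omega
      · omega
    · rw [hcol]
      have := hf2 j'
      split_ifs with h
      · subst h; omega
      · omega
    · have : ¬ (i' = i ∧ j' = j) := by rintro ⟨rfl, rfl⟩; exact h hij
      simp [v, hf3 i' j' h, this]
  have hw : matchingWeight q v = matchingWeight q (y q a) + (q.1 i + q.2 j) := by
    simp only [matchingWeight, v, add_mul, Finset.sum_add_distrib]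
    congr 1
    rw [Finset.sum_eq_single i (fun i' _ h => by simp [h]) (by simp),
      Finset.sum_eq_single j (fun j' _ h => by simp [h]) (by simp)]
    simp
  have := hmax v hv
  omega

theorem FeasibleMatching.le_of_mem_separatedStates {E : Set (Fin n × Fin m)} {N : ℕ}
    {q a : State n m} (hq : q ∈ separatedStates E N) (ha : ArrivalsLE N a)
    {v : Fin n → Fin m → ℕ} (hv : FeasibleMatching E q a v) (i : Fin n) (j : Fin m) :
    v i j ≤ 2 * N := by
  by_cases hij : (i, j) ∈ E
  · have h1 : v i j ≤ q.1 i + a.1 i :=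
      (Finset.single_le_sum (f := fun j => v i j) (fun _ _ => Nat.zero_le _)
        (Finset.mem_univ j)).trans (hv.1 i)
    have h2 : v i j ≤ q.2 j + a.2 j :=
      (Finset.single_le_sum (f := fun i => v i j) (fun _ _ => Nat.zero_le _)
        (Finset.mem_univ i)).trans (hv.2.1 j)
    have := hq i j hij
    have := ha.1 i
    have := ha.2 j
    omega
  · simp [hv.2.2 i j hij]

/-- The quadratic Lyapunov function. -/
noncomputable def lyapunov (q : State n m) : ℝ :=
  ∑ i, (q.1 i : ℝ) ^ 2 + ∑ j, (q.2 j : ℝ) ^ 2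

theorem lyapunov_nonneg (q : State n m) : 0 ≤ lyapunov q := by
  unfold lyapunov; positivity

theorem matchingWeight_cast (q : State n m) (v : Fin n → Fin m → ℕ) :
    (matchingWeight q v : ℝ) =
      ∑ i, (q.1 i : ℝ) * ((∑ j, v i j : ℕ) : ℝ) + ∑ j, (q.2 j : ℝ) * ((∑ i, v i j : ℕ) : ℝ) := by
  simp only [matchingWeight]
  push_cast
  simp_rw [mul_add, Finset.sum_add_distrib, Finset.mul_sum]
  congr 1
  · exact Finset.sum_congr rfl fun i _ => Finset.sum_congr rfl fun j _ => mul_comm _ _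
  · rw [Finset.sum_comm]
    exact Finset.sum_congr rfl fun i _ => Finset.sum_congr rfl fun j _ => mul_comm _ _

/-- One-step expansion of the Lyapunov function; in a separated state the matching is bounded, and
so is the quadratic remainder. -/
theorem lyapunov_nextState_le {E : Set (Fin n × Fin m)} {N : ℕ} {q a : State n m}
    (hq : q ∈ separatedStates E N) (ha : ArrivalsLE N a) {v : Fin n → Fin m → ℕ}
    (hv : FeasibleMatching E q a v) :
    lyapunov (nextState q a v) ≤ lyapunov q +
      2 * (∑ i, (q.1 i : ℝ) * a.1 i + ∑ j, (q.2 j : ℝ) * a.2 j) - 2 * matchingWeight q v +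
      (n + m) * (N * (1 + 2 * (n + m))) ^ 2 := by
  have sq (x b Y D : ℝ) (hb0 : 0 ≤ b) (hY0 : 0 ≤ Y) (hb : b ≤ D) (hY : Y ≤ D) :
      (x + b - Y) ^ 2 ≤ x ^ 2 + 2 * (x * b) - 2 * (x * Y) + D ^ 2 := by
    have : (b - Y) ^ 2 ≤ D ^ 2 := sq_le_sq' (by linarith) (by linarith)
    nlinarith
  set D : ℝ := N * (1 + 2 * (n + m)) with hD
  have hND : (N : ℝ) ≤ D := by
    rw [hD]
    have hn : (0 : ℝ) ≤ n := n.cast_nonneg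
    have hm : (0 : ℝ) ≤ m := m.cast_nonneg
    exact le_mul_of_one_le_right (by positivity) (by linarith)
  have hle := FeasibleMatching.le_of_mem_separatedStates hq ha hv
  have hrow (i : Fin n) : ((∑ j, v i j : ℕ) : ℝ) ≤ D := by
    have : ∑ j, v i j ≤ N * (1 + 2 * (n + m)) := by
      calc _ ≤ ∑ _j : Fin m, 2 * N := Finset.sum_le_sum fun j _ => hle i j
        _ = N * (2 * m) := by simp; ring
        _ ≤ _ := Nat.mul_le_mul_left _ (by omega)
    rw [hD]; exact_mod_cast this
  have hcol (j : Fin m) : ((∑ i, v i j : ℕ) : ℝ) ≤ D := by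
    have : ∑ i, v i j ≤ N * (1 + 2 * (n + m)) := by
      calc _ ≤ ∑ _i : Fin n, 2 * N := Finset.sum_le_sum fun i _ => hle i j
        _ = N * (2 * n) := by simp; ring
        _ ≤ _ := Nat.mul_le_mul_left _ (by omega)
    rw [hD]; exact_mod_cast this
  have h1 : ∑ i, ((nextState q a v).1 i : ℝ) ^ 2 ≤ ∑ i, ((q.1 i : ℝ) ^ 2 + 2 * ((q.1 i : ℝ) * a.1 i)
      - 2 * ((q.1 i : ℝ) * ((∑ j, v i j : ℕ) : ℝ)) + D ^ 2) := by
    refine Finset.sum_le_sum fun i _ => ?_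
    simp only [nextState]
    rw [Nat.cast_sub (hv.1 i), Nat.cast_add]
    exact sq _ _ _ _ (by positivity) (by positivity)
      (le_trans (by exact_mod_cast ha.1 i) hND) (hrow i)
  have h2 : ∑ j, ((nextState q a v).2 j : ℝ) ^ 2 ≤ ∑ j, ((q.2 j : ℝ) ^ 2 + 2 * ((q.2 j : ℝ) * a.2 j)
      - 2 * ((q.2 j : ℝ) * ((∑ i, v i j : ℕ) : ℝ)) + D ^ 2) := by
    refine Finset.sum_le_sum fun j _ => ?_
    simp only [nextState]
    rw [Nat.cast_sub (hv.2.1 j), Nat.cast_add]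
    exact sq _ _ _ _ (by positivity) (by positivity)
      (le_trans (by exact_mod_cast ha.2 j) hND) (hcol j)
  rw [matchingWeight_cast]
  simp only [Finset.sum_add_distrib, Finset.sum_sub_distrib, ← Finset.mul_sum, Finset.sum_const,
    Finset.card_univ, Fintype.card_fin, nsmul_eq_mul] at h1 h2
  unfold lyapunov
  linarith

/-- `x` if it exceeds `T`, and `0` otherwise. -/
def cutoff (T x : ℕ) : ℕ := if T < x then x else 0

theorem le_cutoff_add (T x : ℕ) : x ≤ cutoff T x + T := by
  unfold cutoff; split_ifs <;> omega

/-- The length beyond which a queue counts as long. It is at least the number of agents that the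
matching of `le_matchingWeight` sends to one queue. -/
def longQueue (n m N : ℕ) : ℕ := (n + m + 1) * (N + 1)

/-- A lower bound for the max-weight value, from one feasible matching: if the queue `σ j` is long,
it takes all arriving customers of type `j` and one waiting customer, if there is one, and if the
queue `τ i` is long, it takes all arriving servers of queue `i`. -/
theorem le_matchingWeight {E : Set (Fin n × Fin m)} {y : MatchingRule n m}
    (hy : IsMaxWeight E y) {N : ℕ} {q a : State n m} (hq : q ∈ separatedStates E N)
    (ha : ArrivalsLE N a) {σ : Fin m → Fin n} (hσ : ∀ j, (σ j, j) ∈ E)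
    {τ : Fin n → Fin m} (hτ : ∀ i, (i, τ i) ∈ E) {T : ℕ} (hT : T = longQueue n m N) :
    ∑ j, (a.2 j + min (q.2 j) 1) * cutoff T (q.1 (σ j)) + ∑ i, a.1 i * cutoff T (q.2 (τ i))
      ≤ matchingWeight q (y q a) := by
  rw [longQueue] at hT
  have hmT : m * (N + 1) ≤ T := by rw [hT]; exact Nat.mul_le_mul_right _ (by omega)
  have hnT : n * (N + 1) ≤ T := by rw [hT]; exact Nat.mul_le_mul_right _ (by omega)
  have hNT : N ≤ T := by
    rw [hT]; exact (Nat.le_succ N).trans (Nat.le_mul_of_pos_left _ (by omega))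
  let v₁ : Fin n → Fin m → ℕ := fun i j =>
    if i = σ j ∧ T < q.1 i then a.2 j + min (q.2 j) 1 else 0
  let v₂ : Fin n → Fin m → ℕ := fun i j => if j = τ i ∧ T < q.2 j then a.1 i else 0
  -- in a separated state the two parts of the matching never use the same queue
  have hlong (i : Fin n) (j : Fin m) (hij : (i, j) ∈ E) : ¬ (T < q.1 i ∧ T < q.2 j) := by
    have := hq i j hij
    omega
  have hv₁_le (i : Fin n) (j : Fin m) : v₁ i j ≤ N + 1 := by
    simp only [v₁]; have := ha.2 j; split_ifs <;> omega
  have hv₂_le (i : Fin n) (j : Fin m) : v₂ i j ≤ N + 1 := by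
    simp only [v₂]; have := ha.1 i; split_ifs <;> omega
  have hv : FeasibleMatching E q a (fun i j => v₁ i j + v₂ i j) := by
    refine ⟨fun i => ?_, fun j => ?_, fun i j h => ?_⟩
    · simp only [Finset.sum_add_distrib]
      by_cases hi : T < q.1 i
      · have e : ∑ j, v₂ i j = 0 := by
          refine Finset.sum_eq_zero fun j _ => if_neg ?_
          rintro ⟨rfl, hj⟩
          exact hlong i _ (hτ i) ⟨hi, hj⟩
        have : ∑ j, v₁ i j ≤ m * (N + 1) := by
          calc _ ≤ ∑ _j : Fin m, (N + 1) := Finset.sum_le_sum fun j _ => hv₁_le i j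
            _ = _ := by simp
        omega
      · have e : ∑ j, v₁ i j = 0 := Finset.sum_eq_zero fun j _ => if_neg fun h => hi h.2
        have : ∑ j, v₂ i j ≤ a.1 i := by
          rw [Finset.sum_eq_single (τ i) (fun j _ h => if_neg fun h' => h h'.1) (by simp)]
          simp only; split_ifs <;> omega
        omega
    · simp only [Finset.sum_add_distrib]
      by_cases hj : T < q.2 j
      · have e : ∑ i, v₁ i j = 0 := by
          refine Finset.sum_eq_zero fun i _ => if_neg ?_
          rintro ⟨rfl, hi⟩
          exact hlong _ j (hσ j) ⟨hi, hj⟩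
        have : ∑ i, v₂ i j ≤ n * (N + 1) := by
          calc _ ≤ ∑ _i : Fin n, (N + 1) := Finset.sum_le_sum fun i _ => hv₂_le i j
            _ = _ := by simp
        omega
      · have e : ∑ i, v₂ i j = 0 := Finset.sum_eq_zero fun i _ => if_neg fun h => hj h.2
        have : ∑ i, v₁ i j ≤ a.2 j + min (q.2 j) 1 := by
          rw [Finset.sum_eq_single (σ j) (fun i _ h => if_neg fun h' => h h'.1) (by simp)]
          simp only; split_ifs <;> omega
        omega
    · have h1 : v₁ i j = 0 := if_neg (by rintro ⟨rfl, _⟩; exact h (hσ j))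
      have h2 : v₂ i j = 0 := if_neg (by rintro ⟨rfl, _⟩; exact h (hτ i))
      simp [h1, h2]
  refine le_trans ?_ ((hy q a).2 _ hv)
  have e : matchingWeight q (fun i j => v₁ i j + v₂ i j)
      = ∑ j, ∑ i, v₁ i j * (q.1 i + q.2 j) + ∑ i, ∑ j, v₂ i j * (q.1 i + q.2 j) := by
    simp only [matchingWeight, add_mul, Finset.sum_add_distrib]
    rw [Finset.sum_comm (f := fun i j => v₁ i j * (q.1 i + q.2 j))]
  rw [e]
  refine Nat.add_le_add (Finset.sum_le_sum fun j _ => ?_) (Finset.sum_le_sum fun i _ => ?_)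
  · refine le_trans ?_ (Finset.single_le_sum (fun _ _ => Nat.zero_le _) (Finset.mem_univ (σ j)))
    simp only [cutoff, v₁, true_and]
    split_ifs
    · exact Nat.mul_le_mul_left _ (by omega)
    · simp
  · refine le_trans ?_ (Finset.single_le_sum (fun _ _ => Nat.zero_le _) (Finset.mem_univ (τ i)))
    simp only [cutoff, v₂, true_and]
    split_ifs
    · exact Nat.mul_le_mul_left _ (by omega)
    · simp

/-! ### The drift of the queue lengths -/

/-- A law of arrivals in one period that is almost surely bounded by `N` and has means `u`
(servers) and `r` (customers). -/
structure IsArrivalLaw (ρ : Measure (State n m)) (N : ℕ) (u : Fin n → ℝ) (r : Fin m → ℝ) :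
    Prop where
  prob : IsProbabilityMeasure ρ
  le : ∀ᵐ a ∂ρ, ArrivalsLE N a
  mean_server : ∀ i, ∫ a, (a.1 i : ℝ) ∂ρ = u i
  mean_customer : ∀ j, ∫ a, (a.2 j : ℝ) ∂ρ = r j

theorem integrable_of_ae_abs_le {Z : Type*} [Countable Z] [MeasurableSpace Z]
    [MeasurableSingletonClass Z] {ρ : Measure Z} [IsFiniteMeasure ρ] {g : Z → ℝ} {C : ℝ}
    (h : ∀ᵐ z ∂ρ, |g z| ≤ C) : Integrable g ρ :=
  Integrable.of_bound (measurable_of_countable g).aestronglyMeasurable C h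

namespace IsArrivalLaw

variable {ρ : Measure (State n m)} {N : ℕ} {u : Fin n → ℝ} {r : Fin m → ℝ}

theorem integrable_server (h : IsArrivalLaw ρ N u r) (i : Fin n) :
    Integrable (fun a => (a.1 i : ℝ)) ρ := by
  have := h.prob
  refine integrable_of_ae_abs_le (C := N) (h.le.mono fun a ha => ?_)
  rw [abs_of_nonneg (by positivity)]
  exact_mod_cast ha.1 i

theorem integrable_customer (h : IsArrivalLaw ρ N u r) (j : Fin m) :
    Integrable (fun a => (a.2 j : ℝ)) ρ := by
  have := h.prob
  refine integrable_of_ae_abs_le (C := N) (h.le.mono fun a ha => ?_)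
  rw [abs_of_nonneg (by positivity)]
  exact_mod_cast ha.2 j

end IsArrivalLaw

/-- Averaging proper arrivals over the random server rates. -/
theorem isArrivalLaw_bind {M : Market n m} {A : ℝ} {r : Fin m → ℝ} {α : Measure (Fin n → ℝ)}
    [IsProbabilityMeasure α] (h : ∀ᵐ μ ∂α, M.ProperArrivals A r μ) :
    IsArrivalLaw (α.bind (M.arrivals r)) ⌈A⌉₊ (fun i => ∫ μ, μ i ∂α) r := by
  have := M.arrivals_markov r
  have hms (s : Set (State n m)) : MeasurableSet s := s.to_countable.measurableSet
  have hle : ∀ᵐ a ∂(α.bind (M.arrivals r)), ArrivalsLE ⌈A⌉₊ a := by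
    refine Measure.ae_comp_of_ae_ae (hms _) (h.mono fun μ hμ => hμ.1.mono fun a ha => ?_)
    exact ⟨fun i => by exact_mod_cast (ha.1 i).trans (Nat.le_ceil A),
      fun j => by exact_mod_cast (ha.2 j).trans (Nat.le_ceil A)⟩
  have mean (g : State n m → ℝ) (hg : ∀ a, ArrivalsLE ⌈A⌉₊ a → |g a| ≤ ⌈A⌉₊) :
      ∫ a, g a ∂(α.bind (M.arrivals r)) = ∫ μ, ∫ a, g a ∂M.arrivals r μ ∂α := by
    have e : (M.arrivals r ∘ₖ Kernel.const Unit α) () = α.bind (M.arrivals r) := by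
      rw [Kernel.comp_apply, Kernel.const_apply]
    have := Kernel.integral_comp (η := M.arrivals r) (κ := Kernel.const Unit α) (a := ()) (f := g)
      (by rw [e]; exact integrable_of_ae_abs_le (hle.mono hg))
    rwa [e, Kernel.const_apply] at this
  refine ⟨inferInstance, hle, fun i => ?_, fun j => ?_⟩
  · rw [mean _ fun a ha => ?_]
    · exact integral_congr_ae (h.mono fun μ hμ => hμ.2.1 i)
    · rw [abs_of_nonneg (by positivity)]
      exact_mod_cast ha.1 i
  · rw [mean _ fun a ha => ?_]
    · rw [integral_congr_ae (h.mono fun μ hμ => hμ.2.2 j)]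
      simp
    · rw [abs_of_nonneg (by positivity)]
      exact_mod_cast ha.2 j

/-- The total number of agents in the system. -/
noncomputable def queueSize (q : State n m) : ℝ := ∑ i, (q.1 i : ℝ) + ∑ j, (q.2 j : ℝ)

theorem queueSize_nonneg (q : State n m) : 0 ≤ queueSize q := by
  unfold queueSize; positivity

theorem finite_setOf_queueSize_le (R : ℝ) : {q : State n m | queueSize q ≤ R}.Finite := by
  refine Set.Finite.subset ((Set.finite_Icc (0 : Fin n → ℕ) fun _ => ⌊R⌋₊).prod
    (Set.finite_Icc (0 : Fin m → ℕ) fun _ => ⌊R⌋₊)) fun q hq => ?_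
  have hq : queueSize q ≤ R := hq
  have h1 : 0 ≤ ∑ i, (q.1 i : ℝ) := by positivity
  have h2 : 0 ≤ ∑ j, (q.2 j : ℝ) := by positivity
  unfold queueSize at hq
  refine ⟨⟨fun _ => Nat.zero_le _, fun i => Nat.le_floor ?_⟩,
    ⟨fun _ => Nat.zero_le _, fun j => Nat.le_floor ?_⟩⟩
  · have := Finset.single_le_sum (f := fun i => (q.1 i : ℝ)) (fun _ _ => by positivity)
      (Finset.mem_univ i)
    linarith
  · have := Finset.single_le_sum (f := fun j => (q.2 j : ℝ)) (fun _ _ => by positivity)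
      (Finset.mem_univ j)
    linarith

/-- The additive constant of the drift inequality; it does not depend on the price gap. -/
noncomputable def driftConst (N : ℕ) (u : Fin n → ℝ) (l : Fin m → ℝ) : ℝ :=
  2 * longQueue n m N * (∑ j, l j + ∑ i, u i + 1) + (n + m) * (N * (1 + 2 * (n + m))) ^ 2

/-- The fluid flow `χ` bounds the linear part of the drift: a long server queue `i` sends its
inflow `u i` along `χ` to customer types whose chosen queue is at least as long, and symmetrically
for long customer queues. The gap `ε` in the customer rates makes every queue shrink. -/
theorem linear_drift_le {E : Set (Fin n × Fin m)} {χ : Fin n → Fin m → ℝ}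
    {u : Fin n → ℝ} {l r : Fin m → ℝ} (hl : ∀ j, l j = ∑ i, χ i j) (hu : ∀ i, u i = ∑ j, χ i j)
    (hχ : ∀ i j, 0 ≤ χ i j) (hoff : ∀ i j, (i, j) ∉ E → χ i j = 0)
    {ε : ℝ} (hε0 : 0 ≤ ε) (hε : ε ≤ 1 / 2) {q : State n m}
    (hr : ∀ j, r j = if q.2 j = 0 then l j + ε else l j - ε)
    {σ : Fin m → Fin n} (hσ : ∀ i j, (i, j) ∈ E → q.1 i ≤ q.1 (σ j))
    {τ : Fin n → Fin m} (hτE : ∀ i, (i, τ i) ∈ E) (hτ : ∀ i j, (i, j) ∈ E → q.2 j ≤ q.2 (τ i))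
    (T : ℕ) :
    (∑ i, (q.1 i : ℝ) * u i + ∑ j, (q.2 j : ℝ) * r j)
      - (∑ j, (r j + (min (q.2 j) 1 : ℕ)) * cutoff T (q.1 (σ j)) + ∑ i, u i * cutoff T (q.2 (τ i)))
      ≤ T * (∑ j, l j + ∑ i, u i + 1) - ε / (n + 1) * queueSize q := by
  set X : Fin m → ℝ := fun j => (cutoff T (q.1 (σ j)) : ℝ) with hX
  set W : Fin n → ℝ := fun i => (cutoff T (q.2 (τ i)) : ℝ) with hW
  have hX0 (j : Fin m) : 0 ≤ X j := Nat.cast_nonneg _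
  have hqX (i : Fin n) (j : Fin m) (h : (i, j) ∈ E) : (q.1 i : ℝ) ≤ X j + T := by
    simp only [hX]
    exact_mod_cast (hσ i j h).trans (le_cutoff_add T _)
  have hqW (i : Fin n) (j : Fin m) (h : (i, j) ∈ E) : (q.2 j : ℝ) ≤ W i + T := by
    simp only [hW]
    exact_mod_cast (hτ i j h).trans (le_cutoff_add T _)
  have s1 : ∑ i, (q.1 i : ℝ) * u i ≤ ∑ j, l j * X j + T * ∑ j, l j := by
    calc _ = ∑ i, ∑ j, χ i j * q.1 i := by
          refine Finset.sum_congr rfl fun i _ => ?_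
          rw [hu, Finset.mul_sum]
          exact Finset.sum_congr rfl fun j _ => mul_comm _ _
      _ ≤ ∑ i, ∑ j, χ i j * (X j + T) := by
          refine Finset.sum_le_sum fun i _ => Finset.sum_le_sum fun j _ => ?_
          by_cases h : (i, j) ∈ E
          · exact mul_le_mul_of_nonneg_left (hqX i j h) (hχ i j)
          · simp [hoff i j h]
      _ = ∑ j, l j * (X j + T) := by
          rw [Finset.sum_comm]
          simp_rw [hl, Finset.sum_mul]
      _ = _ := by simp_rw [mul_add, Finset.sum_add_distrib, Finset.mul_sum, mul_comm]
  have s2 : ∑ j, (q.2 j : ℝ) * l j ≤ ∑ i, u i * W i + T * ∑ i, u i := by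
    calc _ = ∑ j, ∑ i, χ i j * q.2 j := by
          refine Finset.sum_congr rfl fun j _ => ?_
          rw [hl, Finset.mul_sum]
          exact Finset.sum_congr rfl fun j _ => mul_comm _ _
      _ ≤ ∑ j, ∑ i, χ i j * (W i + T) := by
          refine Finset.sum_le_sum fun j _ => Finset.sum_le_sum fun i _ => ?_
          by_cases h : (i, j) ∈ E
          · exact mul_le_mul_of_nonneg_left (hqW i j h) (hχ i j)
          · simp [hoff i j h]
      _ = ∑ i, u i * (W i + T) := by
          rw [Finset.sum_comm]
          simp_rw [hu, Finset.sum_mul]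
      _ = _ := by simp_rw [mul_add, Finset.sum_add_distrib, Finset.mul_sum, mul_comm]
  have s3 : ∑ j, (q.2 j : ℝ) * r j = ∑ j, (q.2 j : ℝ) * l j - ε * ∑ j, (q.2 j : ℝ) := by
    rw [Finset.mul_sum, ← Finset.sum_sub_distrib]
    refine Finset.sum_congr rfl fun j _ => ?_
    rw [hr]
    split_ifs with h
    · simp [h]
    · ring
  -- a nonempty customer queue has one waiting customer to offer, which outweighs its lower rate
  have s4 : ∑ j, l j * X j + ε * ∑ j, X j ≤ ∑ j, (r j + (min (q.2 j) 1 : ℕ)) * X j := by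
    rw [Finset.mul_sum, ← Finset.sum_add_distrib]
    refine Finset.sum_le_sum fun j _ => ?_
    rw [← add_mul]
    refine mul_le_mul_of_nonneg_right ?_ (hX0 j)
    rw [hr]
    split_ifs with h
    · simp [h]
    · rw [min_eq_right (by omega : 1 ≤ q.2 j)]
      push_cast
      linarith
  have s5 : ∑ i, (q.1 i : ℝ) ≤ n * (∑ j, X j + T) := by
    calc _ ≤ ∑ _i : Fin n, (∑ j, X j + T) := by
          refine Finset.sum_le_sum fun i _ => (hqX i (τ i) (hτE i)).trans ?_
          gcongr
          exact Finset.single_le_sum (fun j _ => hX0 j) (Finset.mem_univ (τ i))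
      _ = _ := by simp [mul_add]
  have hn : (0 : ℝ) ≤ n := n.cast_nonneg
  have hT : (0 : ℝ) ≤ T := T.cast_nonneg
  have hXs : 0 ≤ ∑ j, X j := Finset.sum_nonneg fun j _ => hX0 j
  have hQ : 0 ≤ ∑ j, (q.2 j : ℝ) := by positivity
  have s6 : ε / (n + 1) * queueSize q ≤ ε * ∑ j, X j + T + ε * ∑ j, (q.2 j : ℝ) := by
    have h1 : queueSize q ≤ (n + 1) * (∑ j, X j + T + ∑ j, (q.2 j : ℝ)) := by
      unfold queueSize
      nlinarith [mul_nonneg hn hQ]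
    calc _ ≤ ε / (n + 1) * ((n + 1) * (∑ j, X j + T + ∑ j, (q.2 j : ℝ))) := by gcongr
      _ = ε * ∑ j, X j + ε * T + ε * ∑ j, (q.2 j : ℝ) := by field_simp
      _ ≤ _ := by nlinarith
  simp only [queueSize] at *
  linarith

theorem exists_longest_neighbours {E : Set (Fin n × Fin m)} {χ : Fin n → Fin m → ℝ}
    (hl : ∀ j, 0 < ∑ i, χ i j) (hu : ∀ i, 0 < ∑ j, χ i j)
    (hoff : ∀ i j, (i, j) ∉ E → χ i j = 0) (q : State n m) :
    (∃ σ : Fin m → Fin n, (∀ j, (σ j, j) ∈ E) ∧ ∀ i j, (i, j) ∈ E → q.1 i ≤ q.1 (σ j)) ∧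
    (∃ τ : Fin n → Fin m, (∀ i, (i, τ i) ∈ E) ∧ ∀ i j, (i, j) ∈ E → q.2 j ≤ q.2 (τ i)) := by
  constructor
  · have (j : Fin m) : ∃ i, (i, j) ∈ E ∧ ∀ i', (i', j) ∈ E → q.1 i' ≤ q.1 i := by
      refine Set.exists_max_image {i | (i, j) ∈ E} q.1 (Set.toFinite _) ?_
      obtain ⟨i, -, hi⟩ := Finset.exists_ne_zero_of_sum_ne_zero (hl j).ne'
      exact ⟨i, by by_contra h; exact hi (hoff i j h)⟩
    choose σ h1 h2 using this
    exact ⟨σ, h1, fun i j h => h2 j i h⟩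
  · have (i : Fin n) : ∃ j, (i, j) ∈ E ∧ ∀ j', (i, j') ∈ E → q.2 j' ≤ q.2 j := by
      refine Set.exists_max_image {j | (i, j) ∈ E} q.2 (Set.toFinite _) ?_
      obtain ⟨j, -, hj⟩ := Finset.exists_ne_zero_of_sum_ne_zero (hu i).ne'
      exact ⟨j, by by_contra h; exact hj (hoff i j h)⟩
    choose τ h1 h2 using this
    exact ⟨τ, h1, h2⟩

/-- The drift of the quadratic Lyapunov function in a separated state. -/
theorem lintegral_lyapunov_add_le {E : Set (Fin n × Fin m)} {χ : Fin n → Fin m → ℝ}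
    {u : Fin n → ℝ} {l r : Fin m → ℝ} (hl : ∀ j, l j = ∑ i, χ i j) (hu : ∀ i, u i = ∑ j, χ i j)
    (hl0 : ∀ j, 0 < l j) (hu0 : ∀ i, 0 < u i)
    (hχ : ∀ i j, 0 ≤ χ i j) (hoff : ∀ i j, (i, j) ∉ E → χ i j = 0)
    {ε : ℝ} (hε0 : 0 ≤ ε) (hε : ε ≤ 1 / 2) {q : State n m}
    (hr : ∀ j, r j = if q.2 j = 0 then l j + ε else l j - ε)
    {y : MatchingRule n m} (hy : IsMaxWeight E y) {N : ℕ} (hq : q ∈ separatedStates E N)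
    {ρ : Measure (State n m)} (hρ : IsArrivalLaw ρ N u r) :
    ∫⁻ a, ENNReal.ofReal (lyapunov (nextState q a (y q a))) ∂ρ +
        ENNReal.ofReal (2 * ε / (n + 1) * queueSize q)
      ≤ ENNReal.ofReal (lyapunov q) + ENNReal.ofReal (driftConst N u l) := by
  have := hρ.prob
  obtain ⟨⟨σ, hσE, hσ⟩, ⟨τ, hτE, hτ⟩⟩ := exists_longest_neighbours
    (fun j => (hl j) ▸ hl0 j) (fun i => (hu i) ▸ hu0 i) hoff q
  set T : ℕ := longQueue n m N with hT
  set B : ℝ := (n + m) * (N * (1 + 2 * (n + m))) ^ 2 with hB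
  let g : State n m → ℝ := fun a => lyapunov q +
    2 * (∑ i, (q.1 i : ℝ) * a.1 i + ∑ j, (q.2 j : ℝ) * a.2 j) -
    2 * (∑ j, ((a.2 j : ℝ) + (min (q.2 j) 1 : ℕ)) * cutoff T (q.1 (σ j)) +
      ∑ i, (a.1 i : ℝ) * cutoff T (q.2 (τ i))) + B
  have hg : ∀ᵐ a ∂ρ, lyapunov (nextState q a (y q a)) ≤ g a := by
    filter_upwards [hρ.le] with a ha
    have h1 := lyapunov_nextState_le hq ha (hy q a).1
    have h2 : ((∑ j, (a.2 j + min (q.2 j) 1) * cutoff T (q.1 (σ j)) +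
        ∑ i, a.1 i * cutoff T (q.2 (τ i)) : ℕ) : ℝ) ≤ matchingWeight q (y q a) :=
      Nat.cast_le.2 (le_matchingWeight hy hq ha hσE hτE hT)
    simp only [g]
    push_cast at h2 ⊢
    linarith
  have i1 := hρ.integrable_server
  have i2 := hρ.integrable_customer
  have e1 : Integrable (fun a => ∑ i, (q.1 i : ℝ) * a.1 i) ρ :=
    integrable_finsetSum _ fun i _ => (i1 i).const_mul _
  have e2 : Integrable (fun a => ∑ j, (q.2 j : ℝ) * a.2 j) ρ :=
    integrable_finsetSum _ fun j _ => (i2 j).const_mul _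
  have e3' (j : Fin m) : Integrable (fun a : State n m =>
      ((a.2 j : ℝ) + (min (q.2 j) 1 : ℕ)) * cutoff T (q.1 (σ j))) ρ :=
    ((i2 j).add (integrable_const _)).mul_const _
  have e3 : Integrable (fun a : State n m =>
      ∑ j, ((a.2 j : ℝ) + (min (q.2 j) 1 : ℕ)) * cutoff T (q.1 (σ j))) ρ :=
    integrable_finsetSum _ fun j _ => e3' j
  have e4 : Integrable (fun a : State n m => ∑ i, (a.1 i : ℝ) * cutoff T (q.2 (τ i))) ρ :=
    integrable_finsetSum _ fun i _ => (i1 i).mul_const _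
  have e12 : Integrable (fun a : State n m =>
      2 * (∑ i, (q.1 i : ℝ) * a.1 i + ∑ j, (q.2 j : ℝ) * a.2 j)) ρ := (e1.add e2).const_mul 2
  have e34 : Integrable (fun a : State n m =>
      2 * (∑ j, ((a.2 j : ℝ) + (min (q.2 j) 1 : ℕ)) * cutoff T (q.1 (σ j)) +
        ∑ i, (a.1 i : ℝ) * cutoff T (q.2 (τ i)))) ρ := (e3.add e4).const_mul 2
  have e0 := (integrable_const (μ := ρ) (lyapunov q))
  have hgi : Integrable g ρ := ((e0.add e12).sub e34).add (integrable_const _)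
  have hgv : ∫ a, g a ∂ρ = lyapunov q + 2 * (∑ i, (q.1 i : ℝ) * u i + ∑ j, (q.2 j : ℝ) * r j) -
      2 * (∑ j, (r j + (min (q.2 j) 1 : ℕ)) * cutoff T (q.1 (σ j)) +
        ∑ i, u i * cutoff T (q.2 (τ i))) + B := by
    have c3 (j : Fin m) : ∫ a, ((a.2 j : ℝ) + (min (q.2 j) 1 : ℕ)) * cutoff T (q.1 (σ j)) ∂ρ
        = (r j + (min (q.2 j) 1 : ℕ)) * cutoff T (q.1 (σ j)) := by
      rw [integral_mul_const, integral_add (i2 j) (integrable_const _), hρ.mean_customer]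
      simp
    have c1 : ∫ a, ∑ i, (q.1 i : ℝ) * a.1 i ∂ρ = ∑ i, (q.1 i : ℝ) * u i := by
      rw [integral_finsetSum _ fun i _ => (i1 i).const_mul _]
      simp_rw [integral_const_mul, hρ.mean_server]
    have c2 : ∫ a, ∑ j, (q.2 j : ℝ) * a.2 j ∂ρ = ∑ j, (q.2 j : ℝ) * r j := by
      rw [integral_finsetSum _ fun j _ => (i2 j).const_mul _]
      simp_rw [integral_const_mul, hρ.mean_customer]
    have c4 : ∫ a, ∑ i, (a.1 i : ℝ) * cutoff T (q.2 (τ i)) ∂ρ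
        = ∑ i, u i * cutoff T (q.2 (τ i)) := by
      rw [integral_finsetSum _ fun i _ => (i1 i).mul_const _]
      simp_rw [integral_mul_const, hρ.mean_server]
    have c5 : ∫ a, ∑ j, ((a.2 j : ℝ) + (min (q.2 j) 1 : ℕ)) * cutoff T (q.1 (σ j)) ∂ρ
        = ∑ j, (r j + (min (q.2 j) 1 : ℕ)) * cutoff T (q.1 (σ j)) := by
      rw [integral_finsetSum _ fun j _ => e3' j]
      simp_rw [c3]
    calc _ = ∫ a, (lyapunov q + 2 * (∑ i, (q.1 i : ℝ) * a.1 i + ∑ j, (q.2 j : ℝ) * a.2 j)) ∂ρ -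
        ∫ a, 2 * (∑ j, ((a.2 j : ℝ) + (min (q.2 j) 1 : ℕ)) * cutoff T (q.1 (σ j)) +
          ∑ i, (a.1 i : ℝ) * cutoff T (q.2 (τ i))) ∂ρ + B := by
          rw [← integral_sub (by exact e0.add e12) e34]
          refine (integral_add ((e0.add e12).sub e34) (integrable_const B)).trans ?_
          simp
      _ = _ := by
          rw [integral_add e0 e12, integral_const_mul, integral_const_mul, integral_add e1 e2,
            integral_add e3 e4, c1, c2, c4, c5]
          simp
  have hlin := linear_drift_le hl hu hχ hoff hε0 hε hr hσ hτE hτ T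
  have hg0 : 0 ≤ᵐ[ρ] g := hg.mono fun a ha => (lyapunov_nonneg _).trans ha
  have hf0 : 0 ≤ 2 * ε / (n + 1) * queueSize q := by
    have := queueSize_nonneg q
    positivity
  have hB0 : 0 ≤ driftConst N u l := by
    have := Finset.sum_nonneg fun j (_ : j ∈ Finset.univ) => (hl0 j).le
    have := Finset.sum_nonneg fun i (_ : i ∈ Finset.univ) => (hu0 i).le
    unfold driftConst
    positivity
  have hfin : ∫ a, g a ∂ρ + 2 * ε / (n + 1) * queueSize q ≤ lyapunov q + driftConst N u l := by
    rw [hgv, driftConst, ← hT, ← hB]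
    have : 2 * ε / (n + 1) * queueSize q = 2 * (ε / (n + 1) * queueSize q) := by ring
    rw [this]
    linarith
  calc _ ≤ ∫⁻ a, ENNReal.ofReal (g a) ∂ρ + ENNReal.ofReal (2 * ε / (n + 1) * queueSize q) := by
        gcongr ?_ + _
        exact lintegral_mono_ae (hg.mono fun a ha => ENNReal.ofReal_le_ofReal ha)
    _ = ENNReal.ofReal (∫ a, g a ∂ρ + 2 * ε / (n + 1) * queueSize q) := by
        rw [← ofReal_integral_eq_lintegral_ofReal hgi hg0,
          ENNReal.ofReal_add (integral_nonneg_of_ae hg0) hf0]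
    _ ≤ ENNReal.ofReal (lyapunov q + driftConst N u l) := ENNReal.ofReal_le_ofReal hfin
    _ = _ := ENNReal.ofReal_add (lyapunov_nonneg q) hB0

/-! ### Optimality in the fluid problem -/

theorem exists_quadratic_remainder_bound {g : ℝ → ℝ} (hg : ContDiffOn ℝ 2 g (Set.Ici 0)) {a : ℝ}
    (ha : 0 < a) :
    ∃ d C : ℝ, HasDerivAt g d a ∧
      ∀ᶠ h in 𝓝 (0 : ℝ), |g (a + h) - g a - d * h| ≤ C * h ^ 2 := by
  have hnhds : Set.Ici (0 : ℝ) ∈ 𝓝 a := Ici_mem_nhds ha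
  have ht := taylor_isLittleO (convex_Ici (0 : ℝ)) (Set.mem_Ici.2 ha.le) (n := 2) (f := g)
    (by exact_mod_cast hg)
  rw [nhdsWithin_eq_nhds.2 hnhds] at ht
  set d := derivWithin g (Set.Ici 0) a with hd
  set c := iteratedDerivWithin 2 g (Set.Ici 0) a with hc
  have hderiv : HasDerivAt g d a := by
    have : DifferentiableWithinAt ℝ g (Set.Ici 0) a :=
      (hg.differentiableOn (by norm_num)) a ha.le
    exact this.hasDerivWithinAt.hasDerivAt hnhds
  refine ⟨d, |c| / 2 + 1, hderiv, ?_⟩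
  have hb := ht.bound one_pos
  have hmap : Tendsto (fun h : ℝ => a + h) (𝓝 0) (𝓝 a) := by
    have : Tendsto (fun h : ℝ => a + h) (𝓝 0) (𝓝 (a + 0)) := tendsto_const_nhds.add tendsto_id
    simpa using this
  filter_upwards [hmap.eventually hb] with h hh
  simp only [taylorWithinEval_succ, taylor_within_zero_eval,
    Real.norm_eq_abs, add_sub_cancel_left, smul_eq_mul] at hh
  norm_num at hh
  rw [← hd, ← hc] at hh
  have e : g (a + h) - g a - d * h = (g (a + h) - (g a + h * d + 1 / 2 * h ^ 2 * c))
      + 1 / 2 * h ^ 2 * c := by ring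
  rw [e]
  refine (abs_add_le _ _).trans ?_
  have : |1 / 2 * h ^ 2 * c| = |c| / 2 * h ^ 2 := by
    rw [abs_mul, abs_of_nonneg (by positivity : (0 : ℝ) ≤ 1 / 2 * h ^ 2)]; ring
  rw [this]
  linarith

theorem Market.IsFluidFeasible.flow_nonneg' {M : Market n m} {x : FluidPoint n m}
    (hx : M.IsFluidFeasible x) (i : Fin n) (j : Fin m) : 0 ≤ x.χ i j := by
  by_cases h : (i, j) ∈ M.E
  · exact hx.flow_nonneg i j h
  · rw [hx.flow_off i j h]

theorem Market.IsFluidOptimal.fluidOptimum_eq {M : Market n m} {x : FluidPoint n m}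
    (hx : M.IsFluidOptimal x) : M.fluidOptimum = M.fluidProfit x := by
  refine IsGreatest.csSup_eq ⟨⟨x, hx.1, rfl⟩, ?_⟩
  rintro _ ⟨x', hx', rfl⟩
  exact hx.2 x' hx'

/-- First-order optimality. As all flows of `x` are positive, `x` can be moved a little both towards
and away from any other flow with the same server rates, so the revenue is stationary along
that line. -/
theorem Market.IsFluidOptimal.sum_deriv_mul_eq_zero {M : Market n m} {x : FluidPoint n m}
    (hx : M.IsFluidOptimal x) (hflow : ∀ i j, (i, j) ∈ M.E → 0 < x.χ i j)
    {χ' : Fin n → Fin m → ℝ} (hoff : ∀ i j, (i, j) ∉ M.E → χ' i j = 0)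
    (hrow : ∀ i, ∑ j, χ' i j = ∫ μ, μ i ∂x.α) {d : Fin m → ℝ}
    (hd : ∀ j, HasDerivAt (fun z => M.F j z * z) (d j) (x.rate j)) :
    ∑ j, d j * (∑ i, χ' i j - x.rate j) = 0 := by
  let δ : Fin m → ℝ := fun j => ∑ i, χ' i j - x.rate j
  let p : ℝ → FluidPoint n m := fun t =>
    ⟨fun j => x.rate j + t * δ j, x.α, fun i j => x.χ i j + t * (χ' i j - x.χ i j)⟩
  have hfeas : ∀ᶠ t in 𝓝 (0 : ℝ), M.IsFluidFeasible (p t) := by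
    have hpos : ∀ᶠ t in 𝓝 (0 : ℝ), ∀ i j, (i, j) ∈ M.E →
        0 < x.χ i j + t * (χ' i j - x.χ i j) := by
      simp only [eventually_all]
      intro i j hij
      have hc : ContinuousAt (fun t : ℝ => x.χ i j + t * (χ' i j - x.χ i j)) 0 := by fun_prop
      refine hc.eventually (lt_mem_nhds ?_)
      simpa using hflow i j hij
    filter_upwards [hpos] with t ht
    refine ⟨hx.1.prob, hx.1.supp, hx.1.integrable_cost, hx.1.integrable_rate, fun j => ?_,
      fun i => ?_, fun i j hij => ?_, fun i j hij => (ht i j hij).le⟩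
    · simp only [p, δ, Finset.sum_add_distrib, ← Finset.mul_sum, Finset.sum_sub_distrib]
      rw [← hx.1.customer_balance]
    · simp only [p, Finset.sum_add_distrib, ← Finset.mul_sum, Finset.sum_sub_distrib]
      rw [hrow, ← hx.1.server_balance]
      ring
    · simp [p, hoff i j hij, hx.1.flow_off i j hij]
  have hmax : IsLocalMax (fun t => M.fluidProfit (p t)) 0 := by
    filter_upwards [hfeas] with t ht
    have : p 0 = x := by simp [p]
    rw [this]
    exact hx.2 _ ht
  have hder : HasDerivAt (fun t => M.fluidProfit (p t)) (∑ j, d j * δ j) 0 := by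
    have hj (j : Fin m) : HasDerivAt
        (fun t => M.F j (x.rate j + t * δ j) * (x.rate j + t * δ j)) (d j * δ j) 0 := by
      have hin : HasDerivAt (fun t : ℝ => x.rate j + t * δ j) (δ j) 0 := by
        simpa using ((hasDerivAt_id (0 : ℝ)).mul_const (δ j)).const_add (x.rate j)
      exact HasDerivAt.comp (h₂ := fun z => M.F j z * z) (0 : ℝ) (by simpa using hd j) hin
    exact (HasDerivAt.fun_sum (u := Finset.univ) fun j _ => hj j).sub_const
      (∫ μ, M.servers.cost μ ∂x.α)
  exact hmax.hasDerivAt_eq_zero hder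

/-! ### The chain under the two-price policy -/

/-- The law of the arrivals of one period in state `q`, averaged over the server rates. -/
noncomputable def Market.arrivalLaw (M : Market n m) (π : Policy n m) (q : State n m) :
    Measure (State n m) :=
  (π.α q).bind (M.arrivals (π.rate q))

theorem Market.transition_apply (M : Market n m) (π : Policy n m) (q : State n m) :
    M.transition π q = (M.arrivalLaw π q).map fun a => nextState q a (π.matching q a) :=
  rfl

/-- The mean number of pairs `(i, j)` matched in state `q`. -/
noncomputable def Market.meanMatching (M : Market n m) (π : Policy n m) (q : State n m) (i : Fin n)
    (j : Fin m) : ℝ :=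
  ∫ a, (π.matching q a i j : ℝ) ∂M.arrivalLaw π q

/-- The two-price policy with gap `ε` around a feasible fluid point with positive rates, in a market
whose arrivals are bounded by `N` and have the posted means in every state. -/
structure IsTwoPriceChain (M : Market n m) (x : FluidPoint n m) (ε : ℝ) (y : MatchingRule n m)
    (N : ℕ) : Prop where
  feasible : M.IsFluidFeasible x
  rate_pos : ∀ j, 0 < x.rate j
  server_pos : ∀ i, 0 < ∫ μ, μ i ∂x.α
  gap_pos : 0 < ε
  gap_le : ε ≤ 1 / 2
  maxWeight : IsMaxWeight M.E y
  law : ∀ q, IsArrivalLaw (M.arrivalLaw (twoPricePolicy x ε y) q) N (fun i => ∫ μ, μ i ∂x.α)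
    ((twoPricePolicy x ε y).rate q)

namespace IsTwoPriceChain

variable {M : Market n m} {x : FluidPoint n m} {ε : ℝ} {y : MatchingRule n m} {N : ℕ}

theorem isMarkovKernel (h : IsTwoPriceChain M x ε y N) :
    IsMarkovKernel (M.transition (twoPricePolicy x ε y)) := by
  refine ⟨fun q => ?_⟩
  have := (h.law q).prob
  rw [Market.transition_apply]
  exact Measure.isProbabilityMeasure_map (measurable_of_countable _).aemeasurable

theorem ae_transition_mem (h : IsTwoPriceChain M x ε y N) (q : State n m) :
    ∀ᵐ w ∂M.transition (twoPricePolicy x ε y) q, w ∈ separatedStates M.E N := by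
  rw [Market.transition_apply, ae_map_iff (measurable_of_countable _).aemeasurable
    (Set.to_countable _).measurableSet]
  filter_upwards [(h.law q).le] with a ha
  exact nextState_mem_separatedStates h.maxWeight q ha

theorem ae_mem_separatedStates (h : IsTwoPriceChain M x ε y N) {ψ : Measure (State n m)}
    (hψ : Kernel.Invariant (M.transition (twoPricePolicy x ε y)) ψ) :
    ∀ᵐ q ∂ψ, q ∈ separatedStates M.E N := by
  rw [← hψ.def]
  exact Measure.ae_comp_of_ae_ae (Set.to_countable _).measurableSet
    (ae_of_all _ h.ae_transition_mem)

open scoped Classical in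
/-- The drift inequality in the form of the Foster criterion. Non-separated states are never
entered, and are given an infinite Lyapunov function. -/
theorem drift (h : IsTwoPriceChain M x ε y N) (q : State n m) :
    ∫⁻ w, (if w ∈ separatedStates M.E N then ENNReal.ofReal (lyapunov w) else ∞)
        ∂M.transition (twoPricePolicy x ε y) q +
        ENNReal.ofReal (2 * ε / (n + 1) * queueSize q)
      ≤ (if q ∈ separatedStates M.E N then ENNReal.ofReal (lyapunov q) else ∞) +
        ENNReal.ofReal (driftConst N (fun i => ∫ μ, μ i ∂x.α) x.rate) := by
  by_cases hq : q ∈ separatedStates M.E N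
  · rw [if_pos hq]
    rw [lintegral_congr_ae (g := fun w => ENNReal.ofReal (lyapunov w))
      ((h.ae_transition_mem q).mono fun w hw => if_pos hw), Market.transition_apply,
      lintegral_map (measurable_of_countable _) (measurable_of_countable _)]
    exact lintegral_lyapunov_add_le h.feasible.customer_balance h.feasible.server_balance
      h.rate_pos h.server_pos h.feasible.flow_nonneg' h.feasible.flow_off h.gap_pos.le h.gap_le
      (fun j => rfl) h.maxWeight hq (h.law q)
  · simp [hq]

theorem exists_stationary (h : IsTwoPriceChain M x ε y N) :
    ∃ ψ : Measure (State n m), M.IsStationary (twoPricePolicy x ε y) ψ ∧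
      ∀ᵐ q ∂ψ, M.Reachable (twoPricePolicy x ε y) q := by
  classical
  have := h.isMarkovKernel
  have hc : 0 < 2 * ε / (n + 1) := by have := h.gap_pos; positivity
  have hfin (R : ℝ≥0∞) (hR : R ≠ ∞) :
      {q : State n m | ENNReal.ofReal (2 * ε / (n + 1) * queueSize q) ≤ R}.Finite := by
    refine (finite_setOf_queueSize_le (R.toReal / (2 * ε / (n + 1)))).subset fun q hq => ?_
    have hq : ENNReal.ofReal (2 * ε / (n + 1) * queueSize q) ≤ R := hq
    rw [ENNReal.ofReal_le_iff_le_toReal hR] at hq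
    exact (le_div_iff₀' hc).2 hq
  have h0 : (0 : State n m) ∈ separatedStates M.E N := fun i j _ => Or.inl (Nat.zero_le _)
  obtain ⟨ψ, h1, h2, h3⟩ := MarkovChain.exists_invariant_of_drift h.drift ENNReal.ofReal_ne_top
    hfin (z₀ := 0) (by rw [if_pos h0]; exact ENNReal.ofReal_ne_top)
  exact ⟨ψ, ⟨h1, h2⟩, h3⟩

theorem lintegral_queueSize_le (h : IsTwoPriceChain M x ε y N) {ψ : Measure (State n m)}
    (hψ : M.IsStationary (twoPricePolicy x ε y) ψ) :
    ∫⁻ q, ENNReal.ofReal (2 * ε / (n + 1) * queueSize q) ∂ψ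
      ≤ ENNReal.ofReal (driftConst N (fun i => ∫ μ, μ i ∂x.α) x.rate) := by
  classical
  have := h.isMarkovKernel
  have := hψ.1
  refine MarkovChain.lintegral_le_of_drift h.drift hψ.2 ?_
  filter_upwards [h.ae_mem_separatedStates hψ.2] with q hq
  rw [if_pos hq]
  exact ENNReal.ofReal_ne_top

theorem integrable_queueSize (h : IsTwoPriceChain M x ε y N) {ψ : Measure (State n m)}
    (hψ : M.IsStationary (twoPricePolicy x ε y) ψ) : Integrable queueSize ψ := by
  have hc : 0 < 2 * ε / (n + 1) := by have := h.gap_pos; positivity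
  have hi : Integrable (fun q => 2 * ε / (n + 1) * queueSize q) ψ := by
    refine ⟨(measurable_of_countable _).aestronglyMeasurable, ?_⟩
    rw [hasFiniteIntegral_iff_ofReal
      (ae_of_all _ fun q => mul_nonneg hc.le (queueSize_nonneg q))]
    exact (h.lintegral_queueSize_le hψ).trans_lt ENNReal.ofReal_lt_top
  exact (integrable_const_mul_iff hc.ne'.isUnit _).1 hi

theorem driftConst_nonneg (h : IsTwoPriceChain M x ε y N) :
    0 ≤ driftConst N (fun i => ∫ μ, μ i ∂x.α) x.rate := by
  have := Finset.sum_nonneg fun j (_ : j ∈ Finset.univ) => (h.rate_pos j).le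
  have := Finset.sum_nonneg fun i (_ : i ∈ Finset.univ) => (h.server_pos i).le
  unfold driftConst
  positivity

/-- The mean number of waiting agents is of order `1 / ε`. -/
theorem integral_queueSize_le (h : IsTwoPriceChain M x ε y N) {ψ : Measure (State n m)}
    (hψ : M.IsStationary (twoPricePolicy x ε y) ψ) :
    ∫ q, queueSize q ∂ψ ≤
      (n + 1) / 2 * driftConst N (fun i => ∫ μ, μ i ∂x.α) x.rate * ε⁻¹ := by
  have hε := h.gap_pos
  have hc : 0 < 2 * ε / (n + 1) := by positivity
  have hle := h.lintegral_queueSize_le hψ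
  rw [← ofReal_integral_eq_lintegral_ofReal ((h.integrable_queueSize hψ).const_mul _)
    (ae_of_all _ fun q => mul_nonneg hc.le (queueSize_nonneg q)),
    ENNReal.ofReal_le_ofReal_iff h.driftConst_nonneg, integral_const_mul] at hle
  calc _ ≤ driftConst N (fun i => ∫ μ, μ i ∂x.α) x.rate / (2 * ε / (n + 1)) :=
        (le_div_iff₀' hc).2 hle
    _ = _ := by field_simp

section Balance

variable (h : IsTwoPriceChain M x ε y N) {q : State n m} (hq : q ∈ separatedStates M.E N)

include h hq

theorem ae_matching_le (i : Fin n) (j : Fin m) :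
    ∀ᵐ a ∂M.arrivalLaw (twoPricePolicy x ε y) q, |(y q a i j : ℝ)| ≤ (2 * N : ℕ) := by
  filter_upwards [(h.law q).le] with a ha
  rw [abs_of_nonneg (by positivity)]
  exact_mod_cast FeasibleMatching.le_of_mem_separatedStates hq ha (h.maxWeight q a).1 i j

theorem integrable_matching (i : Fin n) (j : Fin m) :
    Integrable (fun a => (y q a i j : ℝ)) (M.arrivalLaw (twoPricePolicy x ε y) q) := by
  have := (h.law q).prob
  exact integrable_of_ae_abs_le (h.ae_matching_le hq i j)

theorem abs_meanMatching_le (i : Fin n) (j : Fin m) :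
    |M.meanMatching (twoPricePolicy x ε y) q i j| ≤ (2 * N : ℕ) := by
  have := (h.law q).prob
  have hb := norm_integral_le_of_norm_le_const (f := fun a => (y q a i j : ℝ))
    (h.ae_matching_le hq i j)
  rwa [probReal_univ, mul_one] at hb

theorem integral_transition_server (i : Fin n) :
    ∫ w, (w.1 i : ℝ) ∂M.transition (twoPricePolicy x ε y) q =
      q.1 i + ∫ μ, μ i ∂x.α - ∑ j, M.meanMatching (twoPricePolicy x ε y) q i j := by
  have := (h.law q).prob
  rw [Market.transition_apply, integral_map (measurable_of_countable _).aemeasurable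
    (measurable_of_countable _).aestronglyMeasurable]
  have e (a : State n m) : ((nextState q a (y q a)).1 i : ℝ) =
      q.1 i + a.1 i - ∑ j, (y q a i j : ℝ) := by
    simp only [nextState]
    rw [Nat.cast_sub ((h.maxWeight q a).1.1 i)]
    push_cast
    rfl
  have hi := (h.law q).integrable_server i
  have hs := integrable_finsetSum Finset.univ fun j _ => h.integrable_matching hq i j
  calc _ = ∫ a, ((q.1 i : ℝ) + a.1 i - ∑ j, (y q a i j : ℝ))
        ∂M.arrivalLaw (twoPricePolicy x ε y) q := integral_congr_ae (ae_of_all _ e)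
    _ = _ := by
        rw [integral_sub (by exact (integrable_const _).add hi) hs,
          integral_add (integrable_const _) hi, (h.law q).mean_server,
          integral_finsetSum _ fun j _ => h.integrable_matching hq i j]
        rw [integral_const, probReal_univ, one_smul]
        rfl

theorem integral_transition_customer (j : Fin m) :
    ∫ w, (w.2 j : ℝ) ∂M.transition (twoPricePolicy x ε y) q =
      q.2 j + (twoPricePolicy x ε y).rate q j -
        ∑ i, M.meanMatching (twoPricePolicy x ε y) q i j := by
  have := (h.law q).prob
  rw [Market.transition_apply, integral_map (measurable_of_countable _).aemeasurable
    (measurable_of_countable _).aestronglyMeasurable]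
  have e (a : State n m) : ((nextState q a (y q a)).2 j : ℝ) =
      q.2 j + a.2 j - ∑ i, (y q a i j : ℝ) := by
    simp only [nextState]
    rw [Nat.cast_sub ((h.maxWeight q a).1.2.1 j)]
    push_cast
    rfl
  have hi := (h.law q).integrable_customer j
  have hs := integrable_finsetSum Finset.univ fun i _ => h.integrable_matching hq i j
  calc _ = ∫ a, ((q.2 j : ℝ) + a.2 j - ∑ i, (y q a i j : ℝ))
        ∂M.arrivalLaw (twoPricePolicy x ε y) q := integral_congr_ae (ae_of_all _ e)
    _ = _ := by
        rw [integral_sub (by exact (integrable_const _).add hi) hs,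
          integral_add (integrable_const _) hi, (h.law q).mean_customer,
          integral_finsetSum _ fun i _ => h.integrable_matching hq i j]
        rw [integral_const, probReal_univ, one_smul]
        rfl

end Balance

theorem abs_rate_sub (h : IsTwoPriceChain M x ε y N) (q : State n m) (j : Fin m) :
    |(twoPricePolicy x ε y).rate q j - x.rate j| = ε := by
  have := h.gap_pos
  simp only [twoPricePolicy]
  split_ifs <;> simp [abs_of_pos this]

section Stationary

variable (h : IsTwoPriceChain M x ε y N) {ψ : Measure (State n m)}
  (hψ : M.IsStationary (twoPricePolicy x ε y) ψ)

include h hψ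

theorem integrable_server_queue (i : Fin n) : Integrable (fun q => (q.1 i : ℝ)) ψ := by
  refine (h.integrable_queueSize hψ).mono' (measurable_of_countable _).aestronglyMeasurable
    (ae_of_all _ fun q => ?_)
  have h1 := Finset.single_le_sum (f := fun i => (q.1 i : ℝ)) (fun _ _ => by positivity)
    (Finset.mem_univ i)
  have h2 : 0 ≤ ∑ j, (q.2 j : ℝ) := by positivity
  rw [Real.norm_of_nonneg (by positivity)]
  unfold queueSize
  linarith

theorem integrable_customer_queue (j : Fin m) : Integrable (fun q => (q.2 j : ℝ)) ψ := by
  refine (h.integrable_queueSize hψ).mono' (measurable_of_countable _).aestronglyMeasurable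
    (ae_of_all _ fun q => ?_)
  have h1 := Finset.single_le_sum (f := fun j => (q.2 j : ℝ)) (fun _ _ => by positivity)
    (Finset.mem_univ j)
  have h2 : 0 ≤ ∑ i, (q.1 i : ℝ) := by positivity
  rw [Real.norm_of_nonneg (by positivity)]
  unfold queueSize
  linarith

theorem integrable_meanMatching (i : Fin n) (j : Fin m) :
    Integrable (fun q => M.meanMatching (twoPricePolicy x ε y) q i j) ψ := by
  have := hψ.1
  exact integrable_of_ae_abs_le ((h.ae_mem_separatedStates hψ.2).mono fun q hq =>
    h.abs_meanMatching_le hq i j)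

theorem integrable_rate (j : Fin m) :
    Integrable (fun q => (twoPricePolicy x ε y).rate q j) ψ := by
  have := hψ.1
  refine integrable_of_ae_abs_le (C := |x.rate j| + ε) (ae_of_all _ fun q => ?_)
  have e := h.abs_rate_sub q j
  have := abs_add_le (x.rate j) ((twoPricePolicy x ε y).rate q j - x.rate j)
  rw [e] at this
  simpa using this

/-- In the stationary regime the servers leave at the rate at which they arrive. -/
theorem sum_integral_meanMatching_server (i : Fin n) :
    ∑ j, ∫ q, M.meanMatching (twoPricePolicy x ε y) q i j ∂ψ = ∫ μ, μ i ∂x.α := by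
  have := hψ.1
  have hi := h.integrable_server_queue hψ i
  have hs := integrable_finsetSum Finset.univ fun j _ => h.integrable_meanMatching hψ i j
  have hinv := MarkovChain.integral_integral_of_invariant hψ.2 hi
  rw [integral_congr_ae ((h.ae_mem_separatedStates hψ.2).mono fun q hq =>
    h.integral_transition_server hq i),
    integral_sub (by exact hi.add (integrable_const _)) hs,
    integral_add hi (integrable_const _),
    integral_finsetSum _ fun j _ => h.integrable_meanMatching hψ i j] at hinv
  simp only [integral_const, probReal_univ, one_smul] at hinv
  linarith

/-- In the stationary regime the customers leave at the mean posted rate. -/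
theorem sum_integral_meanMatching_customer (j : Fin m) :
    ∑ i, ∫ q, M.meanMatching (twoPricePolicy x ε y) q i j ∂ψ =
      ∫ q, (twoPricePolicy x ε y).rate q j ∂ψ := by
  have hi := h.integrable_customer_queue hψ j
  have hr := h.integrable_rate hψ j
  have hs := integrable_finsetSum Finset.univ fun i _ => h.integrable_meanMatching hψ i j
  have hinv := MarkovChain.integral_integral_of_invariant hψ.2 hi
  rw [integral_congr_ae ((h.ae_mem_separatedStates hψ.2).mono fun q hq =>
    h.integral_transition_customer hq j),
    integral_sub (by exact hi.add hr) hs, integral_add hi hr,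
    integral_finsetSum _ fun i _ => h.integrable_meanMatching hψ i j] at hinv
  linarith

/-- The stationary matching rates form a fluid flow with the server rates of `x`, so the mean
deviation of the posted rates from `x.rate` does not change the revenue to first order. -/
theorem sum_deriv_mul_integral_eq_zero (hx : M.IsFluidOptimal x)
    (hflow : ∀ i j, (i, j) ∈ M.E → 0 < x.χ i j) {d : Fin m → ℝ}
    (hd : ∀ j, HasDerivAt (fun z => M.F j z * z) (d j) (x.rate j)) :
    ∑ j, d j * ∫ q, ((twoPricePolicy x ε y).rate q j - x.rate j) ∂ψ = 0 := by
  have := hψ.1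
  rw [← hx.sum_deriv_mul_eq_zero hflow
    (χ' := fun i j => ∫ q, M.meanMatching (twoPricePolicy x ε y) q i j ∂ψ)
    (fun i j hij => ?_) (h.sum_integral_meanMatching_server hψ) hd]
  · refine Finset.sum_congr rfl fun j _ => ?_
    rw [h.sum_integral_meanMatching_customer hψ, integral_sub (h.integrable_rate hψ j)
      (integrable_const _)]
    simp
  · have (q a : State n m) : y q a i j = 0 := (h.maxWeight q a).1.2.2 i j hij
    simp [Market.meanMatching, twoPricePolicy, this]

end Stationary

/-! ### The profit loss -/

/-- The profit loss is at most a second-order revenue loss `η * ε ^ 2` plus a waiting cost of order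
`1 / ε`. -/
theorem integrable_netReward_and_abs_netProfitLoss_le (h : IsTwoPriceChain M x ε y N)
    {ψ : Measure (State n m)} (hψ : M.IsStationary (twoPricePolicy x ε y) ψ)
    (hx : M.IsFluidOptimal x) (hflow : ∀ i j, (i, j) ∈ M.E → 0 < x.χ i j) {d C : Fin m → ℝ}
    (hd : ∀ j, HasDerivAt (fun z => M.F j z * z) (d j) (x.rate j))
    (hC : ∀ j z, |z| = ε →
      |M.F j (x.rate j + z) * (x.rate j + z) - M.F j (x.rate j) * x.rate j - d j * z|
        ≤ C j * z ^ 2)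
    {η : ℝ} (hη : 0 ≤ η) :
    Integrable (M.netReward η (twoPricePolicy x ε y)) ψ ∧
    |M.netProfitLoss η (twoPricePolicy x ε y) ψ| ≤ (∑ j, C j) * (η * ε ^ 2) +
      (∑ i, M.s₁ i + ∑ j, M.s₂ j) *
        ((n + 1) / 2 * driftConst N (fun i => ∫ μ, μ i ∂x.α) x.rate) * ε⁻¹ := by
  have := hψ.1
  set π := twoPricePolicy x ε y with hπ
  let wait : State n m → ℝ := fun q =>
    ∑ i, M.s₁ i * (q.1 i : ℝ) + ∑ j, M.s₂ j * (q.2 j : ℝ)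
  let dev : State n m → Fin m → ℝ := fun q j => π.rate q j - x.rate j
  let rem : State n m → Fin m → ℝ := fun q j =>
    M.F j (π.rate q j) * π.rate q j - M.F j (x.rate j) * x.rate j - d j * dev q j
  have hdev (q : State n m) (j : Fin m) : |dev q j| = ε := h.abs_rate_sub q j
  have hrem (q : State n m) (j : Fin m) : |rem q j| ≤ C j * ε ^ 2 := by
    have := hC j (dev q j) (hdev q j)
    rw [← sq_abs, hdev] at this
    simpa [rem, dev] using this
  have idev (j : Fin m) : Integrable (fun q => dev q j) ψ :=
    (h.integrable_rate hψ j).sub (integrable_const _)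
  have irem (j : Fin m) : Integrable (fun q => rem q j) ψ :=
    integrable_of_ae_abs_le (ae_of_all _ fun q => hrem q j)
  have iwait : Integrable wait ψ :=
    (integrable_finsetSum _ fun i _ => (h.integrable_server_queue hψ i).const_mul _).add
      (integrable_finsetSum _ fun j _ => (h.integrable_customer_queue hψ j).const_mul _)
  have idsum : Integrable (fun q => ∑ j, d j * dev q j) ψ :=
    integrable_finsetSum _ fun j _ => (idev j).const_mul _
  have irsum : Integrable (fun q => ∑ j, rem q j) ψ :=
    integrable_finsetSum _ fun j _ => irem j
  have inner : Integrable (fun q => η * (∑ j, d j * dev q j + ∑ j, rem q j)) ψ :=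
    (idsum.add irsum).const_mul η
  have hreward (q : State n m) : M.netReward η π q =
      η * M.fluidProfit x + η * (∑ j, d j * dev q j + ∑ j, rem q j) - wait q := by
    have e : ∑ j, M.F j (π.rate q j) * π.rate q j =
        ∑ j, M.F j (x.rate j) * x.rate j + (∑ j, d j * dev q j + ∑ j, rem q j) := by
      rw [← Finset.sum_add_distrib, ← Finset.sum_add_distrib]
      refine Finset.sum_congr rfl fun j _ => ?_
      simp only [rem]
      ring
    have e' : π.α q = x.α := rfl
    simp only [Market.netReward, Market.fluidProfit, wait]
    rw [e, e']
    ring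
  have hfun : M.netReward η π =
      fun q => η * M.fluidProfit x + η * (∑ j, d j * dev q j + ∑ j, rem q j) - wait q :=
    funext hreward
  have iconst : Integrable (fun _ : State n m => η * M.fluidProfit x) ψ := integrable_const _
  have hint : Integrable (M.netReward η π) ψ := by
    rw [hfun]
    exact (iconst.add inner).sub iwait
  refine ⟨hint, ?_⟩
  have hzero : ∫ q, ∑ j, d j * dev q j ∂ψ = 0 := by
    rw [integral_finsetSum _ fun j _ => (idev j).const_mul _]
    simp_rw [integral_const_mul]
    exact h.sum_deriv_mul_integral_eq_zero hψ hx hflow hd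
  have hloss : M.netProfitLoss η π ψ = ∫ q, wait q ∂ψ - η * ∫ q, ∑ j, rem q j ∂ψ := by
    rw [Market.netProfitLoss, hx.fluidOptimum_eq, hfun,
      integral_sub (by exact iconst.add inner) iwait, integral_add iconst inner,
      integral_const, probReal_univ, one_smul, integral_const_mul, integral_add idsum irsum, hzero]
    ring
  have hb1 : |∫ q, ∑ j, rem q j ∂ψ| ≤ (∑ j, C j) * ε ^ 2 := by
    have := norm_integral_le_of_norm_le_const (μ := ψ) (f := fun q => ∑ j, rem q j)
      (C := (∑ j, C j) * ε ^ 2) (ae_of_all _ fun q => ?_)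
    · rwa [probReal_univ, mul_one] at this
    · rw [Finset.sum_mul]
      exact (Finset.abs_sum_le_sum_abs _ _).trans (Finset.sum_le_sum fun j _ => hrem q j)
  have hwait0 (q : State n m) : 0 ≤ wait q :=
    add_nonneg (Finset.sum_nonneg fun i _ => mul_nonneg (M.s₁_nonneg i) (Nat.cast_nonneg _))
      (Finset.sum_nonneg fun j _ => mul_nonneg (M.s₂_nonneg j) (Nat.cast_nonneg _))
  have hs1 : 0 ≤ ∑ i, M.s₁ i := Finset.sum_nonneg fun i _ => M.s₁_nonneg i
  have hs2 : 0 ≤ ∑ j, M.s₂ j := Finset.sum_nonneg fun j _ => M.s₂_nonneg j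
  have hwait (q : State n m) : wait q ≤ (∑ i, M.s₁ i + ∑ j, M.s₂ j) * queueSize q := by
    have h1 : ∑ i, M.s₁ i * (q.1 i : ℝ) ≤ (∑ i, M.s₁ i) * ∑ i, (q.1 i : ℝ) := by
      rw [Finset.mul_sum]
      exact Finset.sum_le_sum fun i _ => mul_le_mul_of_nonneg_right
        (Finset.single_le_sum (fun i _ => M.s₁_nonneg i) (Finset.mem_univ i)) (Nat.cast_nonneg _)
    have h2 : ∑ j, M.s₂ j * (q.2 j : ℝ) ≤ (∑ j, M.s₂ j) * ∑ j, (q.2 j : ℝ) := by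
      rw [Finset.mul_sum]
      exact Finset.sum_le_sum fun j _ => mul_le_mul_of_nonneg_right
        (Finset.single_le_sum (fun j _ => M.s₂_nonneg j) (Finset.mem_univ j)) (Nat.cast_nonneg _)
    have q1 : 0 ≤ ∑ i, (q.1 i : ℝ) := by positivity
    have q2 : 0 ≤ ∑ j, (q.2 j : ℝ) := by positivity
    simp only [wait, queueSize]
    linarith [mul_nonneg hs1 q2, mul_nonneg hs2 q1]
  have hb2 : |∫ q, wait q ∂ψ| ≤ (∑ i, M.s₁ i + ∑ j, M.s₂ j) *
      ((n + 1) / 2 * driftConst N (fun i => ∫ μ, μ i ∂x.α) x.rate) * ε⁻¹ := by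
    rw [abs_of_nonneg (integral_nonneg hwait0)]
    calc _ ≤ ∫ q, (∑ i, M.s₁ i + ∑ j, M.s₂ j) * queueSize q ∂ψ :=
          integral_mono iwait ((h.integrable_queueSize hψ).const_mul _) hwait
      _ ≤ (∑ i, M.s₁ i + ∑ j, M.s₂ j) *
          ((n + 1) / 2 * driftConst N (fun i => ∫ μ, μ i ∂x.α) x.rate * ε⁻¹) := by
          rw [integral_const_mul]
          exact mul_le_mul_of_nonneg_left (h.integral_queueSize_le hψ) (add_nonneg hs1 hs2)
      _ = _ := by ring
  rw [hloss]
  refine (abs_sub _ _).trans ?_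
  rw [abs_mul, abs_of_nonneg hη]
  have := mul_le_mul_of_nonneg_left hb1 hη
  linarith

end IsTwoPriceChain

/-- For a small gap the posted rates stay in the neighbourhood in which the arrivals are proper. -/
theorem eventually_isTwoPriceChain {M : Market n m} {x : FluidPoint n m}
    (hx : M.IsFluidFeasible x) (hrate : ∀ j, 0 < x.rate j) (hserver : ∀ i, 0 < ∫ μ, μ i ∂x.α)
    {A : ℝ} (harrivals : ∀ᶠ r in 𝓝 x.rate, ∀ᵐ μ ∂x.α, M.ProperArrivals A r μ) :
    ∀ᶠ ε in 𝓝[>] (0 : ℝ), ∀ y : MatchingRule n m, IsMaxWeight M.E y →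
      IsTwoPriceChain M x ε y ⌈A⌉₊ := by
  have := hx.prob
  obtain ⟨δ, hδ, hball⟩ := Metric.eventually_nhds_iff.1 harrivals
  filter_upwards [self_mem_nhdsWithin, nhdsWithin_le_nhds (gt_mem_nhds hδ),
    nhdsWithin_le_nhds (ge_mem_nhds (by norm_num : (0 : ℝ) < 1 / 2))] with ε hε0 hεδ hε y hy
  have hε0 : 0 < ε := hε0
  refine ⟨hx, hrate, hserver, hε0, hε, hy, fun q => ?_⟩
  have : IsProbabilityMeasure ((twoPricePolicy x ε y).α q) := hx.prob
  refine isArrivalLaw_bind (α := (twoPricePolicy x ε y).α q) (hball ?_)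
  refine lt_of_le_of_lt ((dist_pi_le_iff hε0.le).2 fun j => ?_) hεδ
  rw [Real.dist_eq]
  simp only [twoPricePolicy]
  split_ifs <;> simp [abs_of_pos hε0]

end TwoSidedQueue

open TwoSidedQueue
theorem mainTheorem1 {n m : ℕ} (M : Market n m)
    (x : FluidPoint n m) (hx : M.IsFluidOptimal x)
    (hrate : ∀ j, 0 < x.rate j)
    (hserver : ∀ i, 0 < ∫ μ, μ i ∂x.α)
    (hflow : ∀ i j, (i, j) ∈ M.E → 0 < x.χ i j)
    (A : ℝ)
    (harrivals : ∀ᶠ r in 𝓝 x.rate, ∀ᵐ μ ∂x.α, M.ProperArrivals A r μ) :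
    ∃ K : ℝ, ∀ᶠ η : ℝ in atTop, ∀ y : MatchingRule n m, IsMaxWeight M.E y →
      (∃ ψ : Measure (State n m),
        M.IsStationary (twoPricePolicy x (η ^ (-(1 / 3) : ℝ)) y) ψ ∧
        ∀ᵐ q ∂ψ, M.Reachable (twoPricePolicy x (η ^ (-(1 / 3) : ℝ)) y) q) ∧
      ∀ ψ : Measure (State n m),
        M.IsStationary (twoPricePolicy x (η ^ (-(1 / 3) : ℝ)) y) ψ →
        Integrable (M.netReward η (twoPricePolicy x (η ^ (-(1 / 3) : ℝ)) y)) ψ ∧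
        |M.netProfitLoss η (twoPricePolicy x (η ^ (-(1 / 3) : ℝ)) y) ψ| ≤ K * η ^ (1 / 3 : ℝ) := by
  have hg (j : Fin m) : ContDiffOn ℝ 2 (fun z => M.F j z * z) (Set.Ici 0) :=
    (M.F_contDiff j).mul contDiffOn_id
  choose d C hd hC using fun j => exists_quadratic_remainder_bound (hg j) (hrate j)
  have hgap : Tendsto (fun η : ℝ => η ^ (-(1 / 3) : ℝ)) atTop (𝓝[>] 0) :=
    tendsto_nhdsWithin_iff.2 ⟨tendsto_rpow_neg_atTop (by norm_num),
      (eventually_gt_atTop 0).mono fun η hη => Real.rpow_pos_of_pos hη _⟩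
  have hrem : ∀ᶠ ε in 𝓝[>] (0 : ℝ), ∀ j z, |z| = ε →
      |M.F j (x.rate j + z) * (x.rate j + z) - M.F j (x.rate j) * x.rate j - d j * z|
        ≤ C j * z ^ 2 := by
    obtain ⟨δ, hδ, hball⟩ := Metric.eventually_nhds_iff.1 (eventually_all.2 hC)
    filter_upwards [nhdsWithin_le_nhds (gt_mem_nhds hδ)] with ε hε j z hz
    exact hball (by rwa [Real.dist_eq, sub_zero, hz]) j
  refine ⟨∑ j, C j + (∑ i, M.s₁ i + ∑ j, M.s₂ j) *
    ((n + 1) / 2 * driftConst ⌈A⌉₊ (fun i => ∫ μ, μ i ∂x.α) x.rate), ?_⟩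
  filter_upwards [hgap.eventually (eventually_isTwoPriceChain hx.1 hrate hserver harrivals),
    hgap.eventually hrem, eventually_gt_atTop 0] with η hchain hrem hη y hy
  have h := hchain y hy
  refine ⟨h.exists_stationary, fun ψ hψ => ?_⟩
  obtain ⟨hint, hloss⟩ :=
    h.integrable_netReward_and_abs_netProfitLoss_le hψ hx hflow hd hrem hη.le
  refine ⟨hint, hloss.trans_eq ?_⟩
  -- the gap balances the two losses: `η * ε ^ 2` and `1 / ε` are both `η ^ (1 / 3)`
  have e1 : η * (η ^ (-(1 / 3) : ℝ)) ^ 2 = η ^ (1 / 3 : ℝ) := by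
    rw [← Real.rpow_natCast, ← Real.rpow_mul hη.le]
    nth_rewrite 1 [← Real.rpow_one η]
    rw [← Real.rpow_add hη]
    norm_num
  have e2 : (η ^ (-(1 / 3) : ℝ))⁻¹ = η ^ (1 / 3 : ℝ) := by
    rw [← Real.rpow_neg hη.le, neg_neg]
  rw [e1, e2]
  ring
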